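/- Let $\Bbbk$ be an algebraically closed field of characteristic $0$, let $n,\omega\ge 1$ be integers and let $\gamma\in\Bbbk$ be a primitive $n$th root of $1$. The generalized Liu algebra $B(n,\omega,\gamma)$ is the Hopf algebra generated as an algebra by $x^{\pm1},g,y$ with relations $$xx^{-1}=x^{-1}x=1,\quad xg=gx,\quad xy=yx,\quad yg=\gamma gy,\quad y^n=1-x^\omega=1-g^n,$$ with $\Delta(x)=x\otimes x$, $\Delta(g)=g\otimes g$, $\Delta(y)=1\otimes y+y\otimes g$, $\varepsilon(x)=\varepsilon(g)=1$, $\varepsilon(y)=0$, $S(x)=x^{-1}$, $S(g)=g^{-1}$, $S(y)=-\gamma^{-1}g^{-1}y$. For a Hopf algebra $H$ over $\Bbbk$, its finite dual $H^\circ$ is the Hopf algebra of all linear forms on $H$ that vanish on some two-sided ideal of finite codimension, with the operations dual to those of $H$: $(ff')(h)=\sum f(h_{(1)})f'(h_{(2)})$, unit $\varepsilon_H$, $\sum f_{(1)}(h)f_{(2)}(h')=f(hh')$, $\varepsilon(f)=f(1)$, $S(f)=f\circ S_H$. Let $B_\circ(n,\omega,\gamma)$ be the algebra generated by $F_1$,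 $F_2$ and $\Psi_{\alpha,\beta}$, where $(\alpha,\beta)$ ranges through all pairs in $\Bbbk^*\times\Bbbk^*$ with $\alpha^\omega=\beta^n$, with relations $$\Psi_{\alpha,\beta}\Psi_{\alpha',\beta'}=\Psi_{\alpha\alpha',\beta\beta'},\quad \Psi_{1,1}=1,\quad F_1^n=0,$$ $$F_2\Psi_{\alpha,\beta}=\Psi_{\alpha,\beta}F_2,\quad F_1\Psi_{\alpha,\beta}=\beta\,\Psi_{\alpha,\beta}F_1,\quad F_1F_2=F_2F_1+\tfrac1nF_1 .$$ Put $F_1^{[k]}=\frac{1}{k!_\gamma}F_1^k$ for $1\le k\le n-1$, where $k!_\gamma=\prod_{i=1}^k(1+\gamma+\dots+\gamma^{i-1})$. Theorem 4.4 (Theorem 1.1(2)). (1) The algebra $B_\circ(n,\omega,\gamma)$ is a Hopf algebra with comultiplication, counit and antipode given by $$\Delta(F_1)=1\otimes F_1+F_1\otimes\Psi_{1,\gamma},\qquad \Delta(F_2)=1\otimes F_2+F_2\otimes1-\sum_{k=1}^{n-1}F_1^{[k]}\otimes\Psi_{1,\gamma}^kF_1^{[n-k]},$$ $$\Delta(\Psi_{\alpha,\beta})=(\Psi_{\alpha,\beta}\otimes\Psi_{\alpha,\beta})\Big(1\otimes1+(1-\alpha^\omega)\sum_{k=1}^{n-1}F_1^{[k]}\otimes\Psi_{1,\gamma}^kF_1^{[n-k]}\Big),$$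 $$\varepsilon(\Psi_{\alpha,\beta})=1,\qquad \varepsilon(F_1)=\varepsilon(F_2)=0,$$ $$S(F_1)=-\gamma^{n-1}\Psi_{1,\gamma}^{n-1}F_1,\qquad S(F_2)=-F_2,\qquad S(\Psi_{\alpha,\beta})=\Psi_{\alpha^{-1},\beta^{-1}}.$$ (2) As a Hopf algebra, $B_\circ(n,\omega,\gamma)$ is isomorphic to the finite dual $B(n,\omega,\gamma)^\circ$. -/

import Mathlib

open scoped TensorProduct

noncomputable section

namespace FiniteDual

open Coalgebra WithConv

variable {k H : Type*} [Field k] [Ring H]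

/-- The linear form `f` vanishes on a two-sided ideal of finite codimension. -/
def IsCofinite [Algebra k H] (f : H →ₗ[k] k) : Prop :=
  ∃ I : Ideal H, I.IsTwoSided ∧ FiniteDimensional k (H ⧸ I) ∧ ∀ h ∈ I, f h = 0

theorem IsCofinite.of_factor [Algebra k H] {A : Type*} [Ring A] [Algebra k A]
    [FiniteDimensional k A] (φ : H →ₐ[k] A) (g : A →ₗ[k] k) (f : H →ₗ[k] k)
    (hf : ∀ h, f h = g (φ h)) : IsCofinite f := by
  refine ⟨RingHom.ker φ, inferInstance, ?_, fun h hh => ?_⟩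
  · have hle : (RingHom.ker φ).restrictScalars k ≤ LinearMap.ker φ.toLinearMap := fun x hx => hx
    have hinj : Function.Injective
        (((RingHom.ker φ).restrictScalars k).liftQ φ.toLinearMap hle) := by
      rw [← LinearMap.ker_eq_bot]
      exact Submodule.ker_liftQ_eq_bot _ _ _ (fun x hx => hx)
    have := Module.Finite.of_injective _ hinj
    exact Module.Finite.equiv (Submodule.Quotient.restrictScalarsEquiv k (RingHom.ker φ))
  · rw [hf, show φ h = 0 from hh, map_zero]

theorem IsCofinite.exists_factor [Algebra k H] {f : H →ₗ[k] k} (hf : IsCofinite f) :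
    ∃ (I : Ideal H) (_ : I.IsTwoSided) (_ : FiniteDimensional k (H ⧸ I))
      (g : (H ⧸ I) →ₗ[k] k), ∀ h, f h = g (Ideal.Quotient.mkₐ k I h) := by
  obtain ⟨I, hI, hfin, h0⟩ := hf
  refine ⟨I, hI, hfin, ((I.restrictScalars k).liftQ f h0) ∘ₗ
    (Submodule.Quotient.restrictScalarsEquiv k I).symm.toLinearMap, fun h => rfl⟩

end FiniteDual

open WithConv Coalgebra in
/-- The finite dual `H°` of a Hopf algebra `H`: the linear forms vanishing on a two-sided ideal of
finite codimension, as a subalgebra of the dual space with the convolution product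
`(f * g)(h) = ∑ f(h₁) g(h₂)` and unit `ε`. -/
def finiteDual (k H : Type*) [Field k] [Ring H] [HopfAlgebra k H] :
    Subalgebra k (WithConv (H →ₗ[k] k)) where
  carrier := {f | FiniteDual.IsCofinite f.ofConv}
  add_mem' := by
    intro a b ha hb
    obtain ⟨I, _, _, p, hp⟩ := FiniteDual.IsCofinite.exists_factor ha
    obtain ⟨J, _, _, q, hq⟩ := FiniteDual.IsCofinite.exists_factor hb
    exact .of_factor ((Ideal.Quotient.mkₐ k I).prod (Ideal.Quotient.mkₐ k J))
      (p.coprod q) _ (fun h => by simp [hp, hq])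
  mul_mem' := by
    intro a b ha hb
    obtain ⟨I, _, _, p, hp⟩ := FiniteDual.IsCofinite.exists_factor ha
    obtain ⟨J, _, _, q, hq⟩ := FiniteDual.IsCofinite.exists_factor hb
    refine .of_factor ((Algebra.TensorProduct.map (Ideal.Quotient.mkₐ k I)
      (Ideal.Quotient.mkₐ k J)).comp (Bialgebra.comulAlgHom k H))
      (LinearMap.mul' k k ∘ₗ TensorProduct.map p q) _ (fun h => ?_)
    simp only [(ℛ k h).convMul_apply, hp, hq]
    simp [← (ℛ k h).eq]
  algebraMap_mem' := by
    intro r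
    exact .of_factor (Bialgebra.counitAlgHom k H) (r • LinearMap.id) _ (fun h => by
      simp [Algebra.algebraMap_eq_smul_one])

/-- The finite dual `H°` as a type; it is equipped below with its Hopf algebra structure. -/
def FiniteDual (k H : Type*) [Field k] [Ring H] [HopfAlgebra k H] : Type _ := finiteDual k H

instance (k H : Type*) [Field k] [Ring H] [HopfAlgebra k H] : Ring (FiniteDual k H) :=
  inferInstanceAs (Ring (finiteDual k H))

instance (k H : Type*) [Field k] [Ring H] [HopfAlgebra k H] : Algebra k (FiniteDual k H) :=
  inferInstanceAs (Algebra k (finiteDual k H))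

namespace FiniteDual

open Coalgebra WithConv TensorProduct

variable {k H : Type*} [Field k] [Ring H] [HopfAlgebra k H]

/-- Evaluation of elements of `H°` at `h`. -/
def eval (h : H) : FiniteDual k H →ₗ[k] k where
  toFun f := f.1.ofConv h
  map_add' _ _ := rfl
  map_smul' _ _ := rfl

theorem ext_eval {f g : FiniteDual k H} (hfg : ∀ h, eval h f = eval h g) : f = g :=
  Subtype.ext (WithConv.ext (LinearMap.ext hfg))

/-- Evaluation at `h` of the first tensor factor. -/
def contract (M : Type*) [AddCommMonoid M] [Module k M] (h : H) :
    FiniteDual k H ⊗[k] M →ₗ[k] M :=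
  (TensorProduct.lid k M).toLinearMap ∘ₗ LinearMap.rTensor M (eval h)

theorem contract_tmul {M : Type*} [AddCommMonoid M] [Module k M] (h : H)
    (f : FiniteDual k H) (m : M) : contract M h (f ⊗ₜ m) = eval h f • m := by
  simp [contract]

theorem ext_contract {M : Type*} [AddCommMonoid M] [Module k M] {s t : FiniteDual k H ⊗[k] M}
    (hst : ∀ h, contract M h s = contract M h t) : s = t := by
  classical
  let _ : AddCommGroup M := Module.addCommMonoidToAddCommGroup k
  let b := Module.Basis.ofVectorSpace k M
  apply (TensorProduct.equivFinsuppOfBasisRight b).injective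
  have key : ∀ (h : H) (u : FiniteDual k H ⊗[k] M) i,
      eval h (TensorProduct.equivFinsuppOfBasisRight b u i) = b.repr (contract M h u) i := by
    intro h u i
    induction u with
    | zero => simp
    | add x y hx hy => simp [hx, hy]
    | tmul f m => simp [contract_tmul, mul_comm]
  ext1 i
  exact ext_eval fun h => by rw [key, key, hst]

/-- The pairing of `H° ⊗ H°` with `h ⊗ h'`, that is `f ⊗ g ↦ f(h) g(h')`. -/
def eval₂ (h h' : H) : FiniteDual k H ⊗[k] FiniteDual k H →ₗ[k] k :=
  eval h' ∘ₗ contract _ h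

theorem eval₂_tmul (h h' : H) (f g : FiniteDual k H) :
    eval₂ h h' (f ⊗ₜ g) = eval h f * eval h' g := by
  simp [eval₂, contract_tmul]

theorem ext_eval₂ {s t : FiniteDual k H ⊗[k] FiniteDual k H}
    (hst : ∀ h h', eval₂ h h' s = eval₂ h h' t) : s = t :=
  ext_contract fun h => ext_eval fun h' => hst h h'

theorem exists_comul (f : FiniteDual k H) :
    ∃ t : FiniteDual k H ⊗[k] FiniteDual k H, ∀ h h', eval₂ h h' t = eval (h * h') f := by
  obtain ⟨f, hf⟩ := f
  obtain ⟨I, _, _, g, hg⟩ := IsCofinite.exists_factor hf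
  let π := Ideal.Quotient.mkₐ k I
  let b := Module.finBasis k (H ⧸ I)
  let u (i) : FiniteDual k H := ⟨toConv (b.coord i ∘ₗ π.toLinearMap),
    .of_factor π (b.coord i) _ fun h => rfl⟩
  let v (i) : FiniteDual k H := ⟨toConv (g ∘ₗ LinearMap.mulLeft k (b i) ∘ₗ π.toLinearMap),
    .of_factor π (g ∘ₗ LinearMap.mulLeft k (b i)) _ fun h => rfl⟩
  refine ⟨∑ i, u i ⊗ₜ v i, fun h h' => ?_⟩
  have h1 : eval (h * h') ⟨f, hf⟩ = g (π h * π h') := (hg _).trans (by simp [π])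
  have h2 : ∀ i, eval h (u i) = b.repr (π h) i := fun i => rfl
  have h3 : ∀ i, eval h' (v i) = g (b i * π h') := fun i => rfl
  rw [h1]
  conv_rhs => rw [← b.sum_repr (π h), Finset.sum_mul]
  simp [eval₂_tmul, h2, h3]

/-- The comultiplication of `H°`: the unique linear map with
`∑ f₁(h) f₂(h') = f(h h')`, see `eval₂_comulₗ`. -/
def comulₗ : FiniteDual k H →ₗ[k] FiniteDual k H ⊗[k] FiniteDual k H where
  toFun f := (exists_comul f).choose
  map_add' f g := ext_eval₂ fun h h' => by
    rw [map_add, (exists_comul (f + g)).choose_spec, (exists_comul f).choose_spec,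
      (exists_comul g).choose_spec, map_add]
  map_smul' r f := ext_eval₂ fun h h' => by
    rw [map_smul, (exists_comul (r • f)).choose_spec, RingHom.id_apply,
      (exists_comul f).choose_spec, map_smul]

theorem eval₂_comulₗ (h h' : H) (f : FiniteDual k H) :
    eval₂ h h' (comulₗ f) = eval (h * h') f :=
  (exists_comul f).choose_spec h h'

theorem contract_comulₗ (h h' : H) (f : FiniteDual k H) :
    eval h' (contract _ h (comulₗ f)) = eval (h * h') f :=
  eval₂_comulₗ h h' f

/-- Comultiplication dual to the product of `H`, counit `f ↦ f(1)`. -/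
instance : Coalgebra k (FiniteDual k H) where
  comul := comulₗ
  counit := eval 1
  coassoc := by
    refine LinearMap.ext fun f => ext_contract fun a => ext_contract fun b => ext_eval fun c => ?_
    have h1 : ∀ t : FiniteDual k H ⊗[k] FiniteDual k H,
        eval c (contract _ b (contract _ a
          (TensorProduct.assoc k _ _ _ (LinearMap.rTensor _ comulₗ t)))) = eval₂ (a * b) c t := by
      intro t
      induction t with
      | zero => simp
      | add x y hx hy => simp only [map_add, hx, hy]
      | tmul f g =>
        rw [LinearMap.rTensor_tmul, eval₂_tmul, ← eval₂_comulₗ a b f]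
        generalize comulₗ f = s
        induction s with
        | zero => simp
        | add x y hx hy => simp only [map_add, add_tmul, add_mul, hx, hy]
        | tmul p q => simp [contract_tmul, eval₂_tmul, mul_assoc]
    have h2 : ∀ t : FiniteDual k H ⊗[k] FiniteDual k H,
        eval c (contract _ b (contract _ a (LinearMap.lTensor _ comulₗ t))) =
          eval₂ a (b * c) t := by
      intro t
      induction t with
      | zero => simp
      | add x y hx hy => simp only [map_add, hx, hy]
      | tmul f g => simp [contract_tmul, eval₂_tmul, contract_comulₗ]
    simp only [LinearMap.comp_apply, LinearEquiv.coe_coe]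
    rw [h1, h2, eval₂_comulₗ, eval₂_comulₗ, mul_assoc]
  rTensor_counit_comp_comul := by
    refine LinearMap.ext fun f => (TensorProduct.lid k _).injective (ext_eval fun h => ?_)
    have := contract_comulₗ 1 h f
    rw [one_mul] at this
    simpa [contract] using this
  lTensor_counit_comp_comul := by
    refine LinearMap.ext fun f => (TensorProduct.rid k _).injective (ext_eval fun h => ?_)
    have key : ∀ t : FiniteDual k H ⊗[k] FiniteDual k H,
        eval h (TensorProduct.rid k _ (LinearMap.lTensor _ (eval (1 : H)) t)) = eval₂ h 1 t := by
      intro t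
      induction t with
      | zero => simp
      | add x y hx hy => simp only [map_add, hx, hy]
      | tmul f g => simp [eval₂_tmul, mul_comm]
    rw [LinearMap.comp_apply, key, eval₂_comulₗ, mul_one]
    simp

theorem eval₂_comul (h h' : H) (f : FiniteDual k H) :
    eval₂ h h' (comul (R := k) f) = eval (h * h') f :=
  eval₂_comulₗ h h' f

theorem counit_eq (f : FiniteDual k H) : counit (R := k) f = eval 1 f := rfl

theorem eval_one (h : H) : eval h (1 : FiniteDual k H) = counit (R := k) h := rfl

theorem eval_mul {ι : Type*} {h : H} (r : Repr k h ι) (f g : FiniteDual k H) :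
    eval h (f * g) = ∑ i ∈ r.index, eval (r.left i) f * eval (r.right i) g :=
  r.convMul_apply f.1 g.1

theorem eval₂_mul {ι κ : Type*} {h h' : H} (r : Repr k h ι) (r' : Repr k h' κ)
    (s t : FiniteDual k H ⊗[k] FiniteDual k H) :
    eval₂ h h' (s * t) = ∑ i ∈ r.index, ∑ j ∈ r'.index,
      eval₂ (r.left i) (r'.left j) s * eval₂ (r.right i) (r'.right j) t := by
  induction s with
  | zero => simp
  | add x y hx hy => simp only [map_add, add_mul, hx, hy, Finset.sum_add_distrib]
  | tmul a b =>
    induction t with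
    | zero => simp
    | add x y hx hy => simp only [map_add, mul_add, hx, hy, Finset.sum_add_distrib]
    | tmul c d =>
      rw [Algebra.TensorProduct.tmul_mul_tmul, eval₂_tmul, eval_mul r, eval_mul r',
        Finset.sum_mul_sum]
      refine Finset.sum_congr rfl fun i _ => Finset.sum_congr rfl fun j _ => ?_
      rw [eval₂_tmul, eval₂_tmul]
      ring

instance : Bialgebra k (FiniteDual k H) :=
  Bialgebra.mk' k (FiniteDual k H)
    (by rw [counit_eq, eval_one, Bialgebra.counit_one])
    (by
      intro f g
      let r : Repr k (1 : H) Unit := ⟨{()}, fun _ => 1, fun _ => 1, by simp [Algebra.TensorProduct.one_def]⟩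
      rw [counit_eq, counit_eq, counit_eq, eval_mul r]
      simp [r])
    (ext_eval₂ fun h h' => by
      rw [eval₂_comul, eval_one, Bialgebra.counit_mul, Algebra.TensorProduct.one_def, eval₂_tmul,
        eval_one, eval_one])
    (by
      intro f g
      refine ext_eval₂ fun h h' => ?_
      let r := ℛ k h
      let r' := ℛ k h'
      let q : Repr k (h * h') (_ × _) := ⟨r.index ×ˢ r'.index,
        fun p => r.left p.1 * r'.left p.2, fun p => r.right p.1 * r'.right p.2, by
          rw [Bialgebra.comul_mul, ← r.eq, ← r'.eq, Finset.sum_mul_sum, Finset.sum_product]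
          simp⟩
      rw [eval₂_comul, eval_mul q, eval₂_mul r r', Finset.sum_product]
      simp only [eval₂_comul, q])

theorem map_sum_eval {ι : Type*} (s : Finset ι) (x : ι → H) (f : FiniteDual k H) :
    eval (∑ i ∈ s, x i) f = ∑ i ∈ s, eval (x i) f :=
  map_sum f.1.ofConv x s

theorem eval_smul (c : k) (h : H) (f : FiniteDual k H) : eval (c • h) f = c • eval h f :=
  map_smul f.1.ofConv c h

/-- The antipode of `H°`, namely `f ↦ f ∘ S`. -/
def antipodeₗ : FiniteDual k H →ₗ[k] FiniteDual k H where
  toFun f := ⟨toConv (f.1.ofConv ∘ₗ HopfAlgebra.antipode k), by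
    obtain ⟨I, _, _, g, hg⟩ := IsCofinite.exists_factor f.2
    have : FiniteDimensional k (H ⧸ I)ᵐᵒᵖ :=
      Module.Finite.equiv (MulOpposite.opLinearEquiv k)
    exact .of_factor ((AlgHom.op (Ideal.Quotient.mkₐ k I)).comp (HopfAlgebra.antipodeAlgHomOp k H))
      (g ∘ₗ (MulOpposite.opLinearEquiv k).symm.toLinearMap) _ (fun h => hg _)⟩
  map_add' _ _ := rfl
  map_smul' _ _ := rfl

theorem eval_antipodeₗ (h : H) (f : FiniteDual k H) :
    eval h (antipodeₗ f) = eval (HopfAlgebra.antipode k h) f := rfl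

instance : HopfAlgebra k (FiniteDual k H) where
  antipode := antipodeₗ
  mul_antipode_rTensor_comul := by
    refine LinearMap.ext fun f => ext_eval fun h => ?_
    let r := ℛ k h
    have key : ∀ t : FiniteDual k H ⊗[k] FiniteDual k H,
        eval h (LinearMap.mul' k _ (LinearMap.rTensor _ antipodeₗ t)) =
          ∑ i ∈ r.index, eval₂ (HopfAlgebra.antipode k (r.left i)) (r.right i) t := by
      intro t
      induction t with
      | zero => simp
      | add x y hx hy => simp only [map_add, hx, hy, Finset.sum_add_distrib]
      | tmul f g => simp [eval₂_tmul, eval_mul r, eval_antipodeₗ]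
    rw [LinearMap.comp_apply, LinearMap.comp_apply, key]
    simp only [eval₂_comul]
    rw [← map_sum_eval, HopfAlgebra.sum_antipode_mul_eq_algebraMap_counit r,
      LinearMap.comp_apply, Algebra.linearMap_apply, Algebra.algebraMap_eq_smul_one,
      Algebra.algebraMap_eq_smul_one, map_smul, eval_one, counit_eq, eval_smul, smul_eq_mul,
      smul_eq_mul, mul_comm]
  mul_antipode_lTensor_comul := by
    refine LinearMap.ext fun f => ext_eval fun h => ?_
    let r := ℛ k h
    have key : ∀ t : FiniteDual k H ⊗[k] FiniteDual k H,
        eval h (LinearMap.mul' k _ (LinearMap.lTensor _ antipodeₗ t)) =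
          ∑ i ∈ r.index, eval₂ (r.left i) (HopfAlgebra.antipode k (r.right i)) t := by
      intro t
      induction t with
      | zero => simp
      | add x y hx hy => simp only [map_add, hx, hy, Finset.sum_add_distrib]
      | tmul f g => simp [eval₂_tmul, eval_mul r, eval_antipodeₗ]
    rw [LinearMap.comp_apply, LinearMap.comp_apply, key]
    simp only [eval₂_comul]
    rw [← map_sum_eval, HopfAlgebra.sum_mul_antipode_eq_algebraMap_counit r,
      LinearMap.comp_apply, Algebra.linearMap_apply, Algebra.algebraMap_eq_smul_one,
      Algebra.algebraMap_eq_smul_one, map_smul, eval_one, counit_eq, eval_smul, smul_eq_mul,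
      smul_eq_mul, mul_comm]

end FiniteDual

/-- The quantum binomial coefficients, through the Pascal recursion. -/
def qChoose {k : Type*} [CommRing k] (q : k) : ℕ → ℕ → k
  | _, 0 => 1
  | 0, _ + 1 => 0
  | m + 1, j + 1 => qChoose q m j + q ^ (j + 1) * qChoose q m (j + 1)

section
variable {k : Type*} [CommRing k] (q : k)

theorem qChoose_zero_right (m : ℕ) : qChoose q m 0 = 1 := by cases m <;> rfl

theorem qChoose_succ_succ (m j : ℕ) :
    qChoose q (m + 1) (j + 1) = qChoose q m j + q ^ (j + 1) * qChoose q m (j + 1) := rfl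

theorem qChoose_eq_zero (m j : ℕ) (h : m < j) : qChoose q m j = 0 := by
  induction m generalizing j with
  | zero => cases j with
    | zero => omega
    | succ j => rfl
  | succ m ih => cases j with
    | zero => omega
    | succ j => rw [qChoose_succ_succ, ih j (by omega), ih (j + 1) (by omega)]; simp

theorem qChoose_self (m : ℕ) : qChoose q m m = 1 := by
  induction m with
  | zero => rfl
  | succ m ih => rw [qChoose_succ_succ, ih, qChoose_eq_zero q m (m + 1) (by omega)]; simp

theorem qChoose_mul (m j : ℕ) :
    (1 - q ^ (j + 1)) * qChoose q (m + 1) (j + 1) = (1 - q ^ (m + 1)) * qChoose q m j := by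
  induction m generalizing j with
  | zero => cases j with
    | zero => simp [qChoose]
    | succ j => simp [qChoose]
  | succ m ih => 
    cases j with
    | zero =>
      have := ih 0
      rw [qChoose_succ_succ, qChoose_zero_right]
      rw [qChoose_zero_right] at this
      linear_combination q * this
    | succ j =>
      have h1 := ih j
      have h2 := ih (j + 1)
      rw [qChoose_succ_succ q (m + 1) (j + 1)]
      have h3 := qChoose_succ_succ q m j
      linear_combination q ^ (j + 2) * h2 + q * h1 - q * (1 - q ^ (m + 1)) * h3

theorem mul_pow_of_mul_eq_smul {R : Type*} [Ring R] [Algebra k R] {a b : R}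
    (h : a * b = q • (b * a)) (j : ℕ) : a * b ^ j = q ^ j • (b ^ j * a) := by
  induction j with
  | zero => simp
  | succ j ih =>
    rw [pow_succ b, ← mul_assoc, ih, smul_mul_assoc, mul_assoc, h, mul_smul_comm, smul_smul,
      ← mul_assoc, ← pow_succ]

theorem add_pow_of_mul_eq_smul {R : Type*} [Ring R] [Algebra k R] {a b : R}
    (h : a * b = q • (b * a)) (m : ℕ) :
    (a + b) ^ m = ∑ j ∈ Finset.range (m + 1), qChoose q m j • (b ^ j * a ^ (m - j)) := by
  induction m with
  | zero => simp [qChoose]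
  | succ m ih =>
    have h1 : a * ∑ j ∈ Finset.range (m + 1), qChoose q m j • (b ^ j * a ^ (m - j)) =
        ∑ j ∈ Finset.range (m + 1 + 1), (q ^ j * qChoose q m j) • (b ^ j * a ^ (m + 1 - j)) := by
      rw [Finset.sum_range_succ _ (m + 1), qChoose_eq_zero q m (m + 1) (by omega), mul_zero,
        zero_smul, add_zero, Finset.mul_sum]
      refine Finset.sum_congr rfl fun j hj => ?_
      have hj' : m + 1 - j = m - j + 1 := by have := Finset.mem_range.1 hj; omega
      rw [hj', pow_succ' a, mul_smul_comm, ← mul_assoc, mul_pow_of_mul_eq_smul q h, smul_mul_assoc,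
        smul_smul, mul_comm (q ^ j), mul_assoc]
    rw [pow_succ', ih, add_mul, h1, Finset.sum_range_succ', Finset.sum_range_succ' _ (m + 1),
      Finset.mul_sum, add_right_comm, ← Finset.sum_add_distrib]
    congr 1
    · refine Finset.sum_congr rfl fun j _ => ?_
      rw [qChoose_succ_succ, Nat.add_sub_add_right, add_smul, mul_smul_comm, ← mul_assoc,
        ← pow_succ', add_comm]
    · simp [qChoose_zero_right]

end

theorem add_pow_of_isPrimitiveRoot {k : Type*} [Field k] {q : k} {n : ℕ} (hn : n ≠ 0)
    (hq : IsPrimitiveRoot q n) {R : Type*} [Ring R] [Algebra k R] {a b : R}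
    (h : a * b = q • (b * a)) : (a + b) ^ n = a ^ n + b ^ n := by
  obtain ⟨m, rfl⟩ := Nat.exists_eq_succ_of_ne_zero hn
  rw [add_pow_of_mul_eq_smul q h, Finset.sum_range_succ, Finset.sum_range_succ',
    Finset.sum_eq_zero]
  · simp [qChoose_zero_right, qChoose_self]
  · intro j hj
    have hj := Finset.mem_range.1 hj
    have h1 := qChoose_mul q m j
    rw [show q ^ (m + 1) = 1 from hq.pow_eq_one, sub_self, zero_mul] at h1
    have h2 : 1 - q ^ (j + 1) ≠ 0 :=
      sub_ne_zero.2 (hq.pow_ne_one_of_pos_of_lt (by omega) (by omega)).symm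
    rw [(mul_eq_zero.1 h1).resolve_left h2, zero_smul]

theorem neg_mul_pow_of_isPrimitiveRoot {k : Type*} [Field k] {q : k} {n : ℕ} (hn : n ≠ 0)
    (hq : IsPrimitiveRoot q n) {R : Type*} [Ring R] [Algebra k R] {a b : R}
    (h : b * a = q • (a * b)) : (-(a * b)) ^ n = -(a ^ n * b ^ n) := by
  have key : ∀ m : ℕ, (a * b) ^ m = q ^ (∑ i ∈ Finset.range m, i) • (a ^ m * b ^ m) := by
    intro m
    induction m with
    | zero => simp
    | succ m ih =>
      rw [pow_succ', ih, Finset.sum_range_succ, mul_smul_comm, mul_assoc, ← mul_assoc b,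
        mul_pow_of_mul_eq_smul q h, smul_mul_assoc, mul_smul_comm, smul_smul, ← pow_add,
        mul_assoc, ← pow_succ', ← mul_assoc, ← pow_succ']
  have hT := Finset.sum_range_id_mul_two n
  have hsign : (-1 : k) ^ n * q ^ (∑ i ∈ Finset.range n, i) = -1 := by
    generalize ∑ i ∈ Finset.range n, i = T at hT
    rcases Nat.even_or_odd' n with ⟨c, rfl | rfl⟩
    · have hc : c ≠ 0 := by rintro rfl; simp at hn
      have h1 : q ^ c = -1 := by
        have h2 : q ^ c * q ^ c = 1 := by rw [← pow_add, ← two_mul, hq.pow_eq_one]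
        exact (mul_self_eq_one_iff.1 h2).resolve_left
          (hq.pow_ne_one_of_pos_of_lt hc (by omega))
      have h3 : T = c * (2 * c - 1) := by
        have : T * 2 = (c * (2 * c - 1)) * 2 := by rw [hT]; ring
        omega
      rw [h3, pow_mul q, h1, ← pow_add]
      exact Odd.neg_one_pow ⟨2 * c - 1, by omega⟩
    · have h3 : T = (2 * c + 1) * c := by
        have : T * 2 = ((2 * c + 1) * c) * 2 := by rw [hT, Nat.add_sub_cancel]; ring
        omega
      rw [h3, pow_mul q, hq.pow_eq_one, one_pow, mul_one]
      exact Odd.neg_one_pow ⟨c, rfl⟩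
  rw [← neg_one_smul k (a * b), smul_pow, key, smul_smul, hsign, neg_one_smul]

/-- The generators `x`, `x⁻¹`, `g`, `y` of the generalized Liu algebra. -/
inductive LiuAlgebra.Gen
  | x | xinv | g | y

open LiuAlgebra.Gen FreeAlgebra in
/-- The defining relations `x x⁻¹ = x⁻¹ x = 1`, `x g = g x`, `x y = y x`, `y g = γ g y` and
`y ^ n = 1 - x ^ ω = 1 - g ^ n`. -/
inductive LiuAlgebra.Rel (k : Type*) [Field k] (n ω : ℕ) (γ : k) :
    FreeAlgebra k LiuAlgebra.Gen → FreeAlgebra k LiuAlgebra.Gen → Prop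
  | x_mul_xinv : Rel k n ω γ (ι k x * ι k xinv) 1
  | xinv_mul_x : Rel k n ω γ (ι k xinv * ι k x) 1
  | x_mul_g : Rel k n ω γ (ι k x * ι k g) (ι k g * ι k x)
  | x_mul_y : Rel k n ω γ (ι k x * ι k y) (ι k y * ι k x)
  | y_mul_g : Rel k n ω γ (ι k y * ι k g) (γ • (ι k g * ι k y))
  | y_pow : Rel k n ω γ (ι k y ^ n) (1 - ι k x ^ ω)
  | x_pow : Rel k n ω γ (1 - ι k x ^ ω) (1 - ι k g ^ n)

/-- The generalized Liu algebra `B(n, ω, γ)`, by generators and relations. -/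
def LiuAlgebra (k : Type*) [Field k] (n ω : ℕ) (γ : k) : Type _ :=
  RingQuot (LiuAlgebra.Rel k n ω γ)

namespace LiuAlgebra

variable {k : Type*} [Field k] {n ω : ℕ} {γ : k}

instance : Ring (LiuAlgebra k n ω γ) := inferInstanceAs (Ring (RingQuot (Rel k n ω γ)))

instance : Algebra k (LiuAlgebra k n ω γ) := inferInstanceAs (Algebra k (RingQuot (Rel k n ω γ)))

/-- The class of a generator. -/
def gen (i : Gen) : LiuAlgebra k n ω γ := RingQuot.mkAlgHom k (Rel k n ω γ) (FreeAlgebra.ι k i)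

@[ext]
theorem algHom_ext {A : Type*} [Semiring A] [Algebra k A] {f₁ f₂ : LiuAlgebra k n ω γ →ₐ[k] A}
    (h : ∀ i, f₁ (gen i : LiuAlgebra k n ω γ) = f₂ (gen i : LiuAlgebra k n ω γ)) : f₁ = f₂ :=
  RingQuot.ringQuot_ext' _ _ _ (FreeAlgebra.hom_ext (funext h))

theorem induction {p : LiuAlgebra k n ω γ → Prop} (hgen : ∀ i, p (gen i : LiuAlgebra k n ω γ))
    (hmap : ∀ r, p (algebraMap k _ r)) (hadd : ∀ a b, p a → p b → p (a + b))
    (hmul : ∀ a b, p a → p b → p (a * b)) (a : LiuAlgebra k n ω γ) : p a := by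
  obtain ⟨a, rfl⟩ := RingQuot.mkAlgHom_surjective k (Rel k n ω γ) a
  induction a using FreeAlgebra.induction with
  | grade0 r => rw [AlgHom.commutes]; exact hmap r
  | grade1 i => exact hgen i
  | mul a b ha hb => rw [map_mul]; exact hmul _ _ ha hb
  | add a b ha hb => rw [map_add]; exact hadd _ _ ha hb

theorem of_rel {a b : FreeAlgebra k Gen} (h : Rel k n ω γ a b) :
    RingQuot.mkAlgHom k (Rel k n ω γ) a = RingQuot.mkAlgHom k (Rel k n ω γ) b :=
  RingQuot.mkAlgHom_rel k h

theorem x_mul_xinv : (gen .x : LiuAlgebra k n ω γ) * gen .xinv = 1 := by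
  simpa using! of_rel Rel.x_mul_xinv
theorem xinv_mul_x : (gen .xinv : LiuAlgebra k n ω γ) * gen .x = 1 := by
  simpa using! of_rel Rel.xinv_mul_x
theorem x_mul_g : (gen .x : LiuAlgebra k n ω γ) * gen .g = gen .g * gen .x := by
  simpa using! of_rel Rel.x_mul_g
theorem x_mul_y : (gen .x : LiuAlgebra k n ω γ) * gen .y = gen .y * gen .x := by
  simpa using! of_rel Rel.x_mul_y
theorem y_mul_g : (gen .y : LiuAlgebra k n ω γ) * gen .g = γ • (gen .g * gen .y) := by
  simpa using! of_rel Rel.y_mul_g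
theorem y_pow : (gen .y : LiuAlgebra k n ω γ) ^ n = 1 - gen .x ^ ω := by
  simpa using! of_rel Rel.y_pow
theorem g_pow : (gen .g : LiuAlgebra k n ω γ) ^ n = gen .x ^ ω := by
  have : 1 - (gen .x : LiuAlgebra k n ω γ) ^ ω = 1 - gen .g ^ n := by
    simpa using! of_rel Rel.x_pow
  exact (sub_right_injective this).symm

variable (n ω γ) in
/-- The images `f` of the generators satisfy the defining relations. -/
structure Respects {A : Type*} [Ring A] [Algebra k A] (f : Gen → A) : Prop where
  x_mul_xinv : f .x * f .xinv = 1
  xinv_mul_x : f .xinv * f .x = 1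
  x_mul_g : f .x * f .g = f .g * f .x
  x_mul_y : f .x * f .y = f .y * f .x
  y_mul_g : f .y * f .g = γ • (f .g * f .y)
  y_pow : f .y ^ n = 1 - f .x ^ ω
  x_pow : 1 - f .x ^ ω = 1 - f .g ^ n

theorem Respects.lift_eq {A : Type*} [Ring A] [Algebra k A] {f : Gen → A} (hf : Respects n ω γ f)
    ⦃a b : FreeAlgebra k Gen⦄ (h : Rel k n ω γ a b) :
    FreeAlgebra.lift k f a = FreeAlgebra.lift k f b := by
  cases h
  · simpa using hf.x_mul_xinv
  · simpa using hf.xinv_mul_x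
  · simpa using hf.x_mul_g
  · simpa using hf.x_mul_y
  · simpa using hf.y_mul_g
  · simpa using hf.y_pow
  · simpa using hf.x_pow

/-- The universal property of the presentation. -/
def lift {A : Type*} [Ring A] [Algebra k A] (f : Gen → A) (hf : Respects n ω γ f) :
    LiuAlgebra k n ω γ →ₐ[k] A :=
  RingQuot.liftAlgHom k ⟨FreeAlgebra.lift k f, hf.lift_eq⟩

theorem lift_gen {A : Type*} [Ring A] [Algebra k A] (f : Gen → A) (hf : Respects n ω γ f)
    (i : Gen) : lift f hf (gen i) = f i :=
  (RingQuot.liftAlgHom_mkAlgHom_apply k _ hf.lift_eq _).trans (FreeAlgebra.lift_ι_apply _ _)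

/-- The inverse of `g`. -/
def ginv : LiuAlgebra k n ω γ := gen .g ^ (n - 1) * gen .xinv ^ ω

section

theorem x_commute_g : Commute (gen .x : LiuAlgebra k n ω γ) (gen .g) := x_mul_g

theorem xinv_commute {a : LiuAlgebra k n ω γ} (h : Commute (gen .x) a) : Commute (gen .xinv) a := by
  have : (gen .xinv : LiuAlgebra k n ω γ) * (gen .x * a) * gen .xinv = gen .xinv * (a * gen .x) * gen .xinv := by rw [h.eq]
  rw [← mul_assoc, xinv_mul_x, one_mul, mul_assoc (gen .xinv), mul_assoc a, x_mul_xinv, mul_one] at this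
  exact this.symm

theorem pow_x_mul_pow_xinv (m : ℕ) : (gen .x : LiuAlgebra k n ω γ) ^ m * gen .xinv ^ m = 1 := by
  have h : Commute (gen .x : LiuAlgebra k n ω γ) (gen .xinv) := x_mul_xinv.trans xinv_mul_x.symm
  rw [← h.mul_pow, x_mul_xinv, one_pow]

theorem x_commute_ginv : Commute (gen .x : LiuAlgebra k n ω γ) ginv :=
  (x_commute_g.pow_right _).mul_right
    ((show Commute (gen .x) (gen .xinv) from x_mul_xinv.trans xinv_mul_x.symm).pow_right _)

theorem g_commute_ginv : Commute (gen .g : LiuAlgebra k n ω γ) ginv :=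
  ((Commute.refl (gen .g)).pow_right _).mul_right ((xinv_commute x_commute_g).symm.pow_right _)

variable [NeZero n]

theorem g_mul_ginv : (gen .g : LiuAlgebra k n ω γ) * ginv = 1 := by
  rw [ginv, ← mul_assoc, ← pow_succ', Nat.sub_add_cancel (NeZero.one_le), g_pow,
    pow_x_mul_pow_xinv]

theorem ginv_mul_g : (ginv : LiuAlgebra k n ω γ) * gen .g = 1 := g_commute_ginv.symm.eq.trans g_mul_ginv

theorem ginv_pow : (ginv : LiuAlgebra k n ω γ) ^ n = gen .xinv ^ ω := by
  have h : (gen .g : LiuAlgebra k n ω γ) ^ n * ginv ^ n = 1 := by rw [← g_commute_ginv.mul_pow, g_mul_ginv, one_pow]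
  have h2 : (gen .xinv : LiuAlgebra k n ω γ) ^ ω * gen .x ^ ω = 1 := by
    have h : Commute (gen .xinv : LiuAlgebra k n ω γ) (gen .x) := xinv_mul_x.trans x_mul_xinv.symm
    rw [← h.mul_pow, xinv_mul_x, one_pow]
  rw [g_pow] at h
  rw [← one_mul (ginv ^ n), ← h2, mul_assoc, h, mul_one]

theorem ginv_mul_y : (ginv : LiuAlgebra k n ω γ) * gen .y = γ • (gen .y * ginv) := by
  have : (ginv : LiuAlgebra k n ω γ) * (gen .y * gen .g) * ginv = ginv * (γ • (gen .g * gen .y)) * ginv := by rw [y_mul_g]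
  rw [mul_smul_comm, ← mul_assoc, ← mul_assoc, ginv_mul_g, one_mul, mul_assoc, g_mul_ginv, mul_one,
    smul_mul_assoc] at this
  exact this

/-- Counit on generators. -/
def counitGen : Gen → k
  | .x => 1
  | .xinv => 1
  | .g => 1
  | .y => 0

theorem respects_counitGen : Respects n ω γ (counitGen (k := k)) := by
  constructor <;> simp [counitGen, NeZero.ne n]

/-- The counit of `B(n, ω, γ)`. -/
def counitAlgHom : LiuAlgebra k n ω γ →ₐ[k] k :=
  lift counitGen respects_counitGen

theorem counitAlgHom_gen (i : Gen) : counitAlgHom (gen i : LiuAlgebra k n ω γ) = counitGen i := lift_gen ..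

variable [hγ : Fact (IsPrimitiveRoot γ n)]

theorem antipode_y_eq : -(γ⁻¹ • ((ginv : LiuAlgebra k n ω γ) * gen .y)) = -(gen .y * ginv) := by
  rw [ginv_mul_y, smul_smul, inv_mul_cancel₀ (hγ.out.ne_zero (NeZero.ne n)), one_smul]

open TensorProduct

/-- Comultiplication on generators: `x` and `g` are group-like, `Δ(y) = 1 ⊗ y + y ⊗ g`. -/
def comulGen : Gen → LiuAlgebra k n ω γ ⊗[k] LiuAlgebra k n ω γ
  | .x => gen .x ⊗ₜ gen .x
  | .xinv => gen .xinv ⊗ₜ gen .xinv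
  | .g => gen .g ⊗ₜ gen .g
  | .y => 1 ⊗ₜ gen .y + gen .y ⊗ₜ gen .g

theorem respects_comulGen : Respects n ω γ (comulGen (k := k) (n := n) (ω := ω) (γ := γ)) where
  x_mul_xinv := by simp [comulGen, x_mul_xinv, Algebra.TensorProduct.one_def]
  xinv_mul_x := by simp [comulGen, xinv_mul_x, Algebra.TensorProduct.one_def]
  x_mul_g := by simp [comulGen, x_mul_g]
  x_mul_y := by simp [comulGen, mul_add, add_mul, x_mul_g, x_mul_y]
  y_mul_g := by simp [comulGen, mul_add, add_mul, y_mul_g, smul_tmul']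
  y_pow := by
      have := add_pow_of_isPrimitiveRoot (NeZero.ne n) hγ.out
        (a := (1 : LiuAlgebra k n ω γ) ⊗ₜ[k] (gen .y : LiuAlgebra k n ω γ))
        (b := (gen .y : LiuAlgebra k n ω γ) ⊗ₜ[k] (gen .g : LiuAlgebra k n ω γ))
        (by simp [y_mul_g])
      simp only [comulGen, this, Algebra.TensorProduct.tmul_pow, one_pow, y_pow, g_pow, tmul_sub, sub_tmul,
        Algebra.TensorProduct.one_def]
      abel
  x_pow := by simp [comulGen, g_pow]

open MulOpposite in
/-- Antipode on generators: `S(x) = x⁻¹`, `S(g) = g⁻¹`, `S(y) = -γ⁻¹ g⁻¹ y`. -/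
def antipodeGen : Gen → (LiuAlgebra k n ω γ)ᵐᵒᵖ
  | .x => op (gen .xinv)
  | .xinv => op (gen .x)
  | .g => op ginv
  | .y => op (-(γ⁻¹ • (ginv * gen .y)))

open MulOpposite in
theorem respects_antipodeGen :
    Respects n ω γ (antipodeGen (k := k) (n := n) (ω := ω) (γ := γ)) where
  x_mul_xinv := by simp [antipodeGen, ← op_mul, x_mul_xinv]
  xinv_mul_x := by simp [antipodeGen, ← op_mul, xinv_mul_x]
  x_mul_g := by
      simp only [antipodeGen, ← op_mul]
      rw [(xinv_commute x_commute_ginv).eq]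
  x_mul_y := by
      simp only [antipodeGen, ← op_mul, antipode_y_eq]
      rw [((xinv_commute x_mul_y).mul_right (xinv_commute x_commute_ginv)).neg_right.eq]
  y_mul_g := by
      simp only [antipodeGen, ← op_mul, ← op_smul, antipode_y_eq]
      rw [mul_neg, neg_mul, ← mul_assoc, ginv_mul_y, smul_neg, smul_mul_assoc]
  y_pow := by
      simp only [antipodeGen, ← op_pow, ← op_one, ← op_sub, antipode_y_eq]
      rw [neg_mul_pow_of_isPrimitiveRoot (NeZero.ne n) hγ.out ginv_mul_y, ginv_pow, y_pow, sub_mul,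
        one_mul, pow_x_mul_pow_xinv, neg_sub]
  x_pow := by simp only [antipodeGen, ← op_pow, ginv_pow]

/-- The comultiplication of `B(n, ω, γ)`. -/
def comulAlgHom : LiuAlgebra k n ω γ →ₐ[k] LiuAlgebra k n ω γ ⊗[k] LiuAlgebra k n ω γ :=
  lift comulGen respects_comulGen

/-- The antipode of `B(n, ω, γ)` as an algebra map to the opposite algebra. -/
def antipodeAlgHom : LiuAlgebra k n ω γ →ₐ[k] (LiuAlgebra k n ω γ)ᵐᵒᵖ :=
  lift antipodeGen respects_antipodeGen

theorem comulAlgHom_gen (i : Gen) : comulAlgHom (gen i : LiuAlgebra k n ω γ) = comulGen i := lift_gen ..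

/-- The antipode of `B(n, ω, γ)` as a linear map. -/
def antipodeₗ : LiuAlgebra k n ω γ →ₗ[k] LiuAlgebra k n ω γ :=
  (MulOpposite.opLinearEquiv k).symm.toLinearMap ∘ₗ antipodeAlgHom.toLinearMap

theorem antipodeₗ_gen (i : Gen) : antipodeₗ (gen i : LiuAlgebra k n ω γ) = (antipodeGen i).unop :=
  congrArg MulOpposite.unop (lift_gen ..)

theorem antipodeₗ_mul (a b : LiuAlgebra k n ω γ) :
    antipodeₗ (a * b) = antipodeₗ b * antipodeₗ a := by
  simp [antipodeₗ]

theorem antipodeₗ_algebraMap (r : k) :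
    antipodeₗ (algebraMap k (LiuAlgebra k n ω γ) r) = algebraMap k _ r := by
  simp [antipodeₗ]

theorem antipodeₗ_one : antipodeₗ (1 : LiuAlgebra k n ω γ) = 1 := by
  simpa using antipodeₗ_algebraMap (n := n) (ω := ω) (γ := γ) (1 : k)

instance : Bialgebra k (LiuAlgebra k n ω γ) :=
  Bialgebra.ofAlgHom comulAlgHom counitAlgHom
    (by
      ext i
      cases i <;> simp [comulAlgHom_gen, comulGen, tmul_add, add_tmul,
        Algebra.TensorProduct.one_def, add_assoc])
    (by ext i; cases i <;> simp [comulAlgHom_gen, comulGen, counitAlgHom_gen, counitGen])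
    (by ext i; cases i <;> simp [comulAlgHom_gen, comulGen, counitAlgHom_gen, counitGen])

theorem mul_rTensor_antipodeₗ {s : LiuAlgebra k n ω γ ⊗[k] LiuAlgebra k n ω γ} {r : k}
    (hs : LinearMap.mul' k _ (antipodeₗ.rTensor _ s) = algebraMap k _ r)
    (t : LiuAlgebra k n ω γ ⊗[k] LiuAlgebra k n ω γ) :
    LinearMap.mul' k _ (antipodeₗ.rTensor _ (s * t)) =
      r • LinearMap.mul' k _ (antipodeₗ.rTensor _ t) := by
  induction t with
  | zero => simp
  | add x y hx hy => simp only [mul_add, map_add, hx, hy, smul_add]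
  | tmul c d =>
    have key : LinearMap.mul' k _ (antipodeₗ.rTensor _ (s * c ⊗ₜ d)) =
        antipodeₗ c * LinearMap.mul' k _ (antipodeₗ.rTensor _ s) * d := by
      clear hs
      induction s with
      | zero => simp
      | add x y hx hy => simp only [add_mul, map_add, hx, hy, mul_add]
      | tmul a b => simp [antipodeₗ_mul, mul_assoc]
    rw [key, hs, ← Algebra.commutes, Algebra.algebraMap_eq_smul_one]
    simp

theorem mul_lTensor_antipodeₗ {t : LiuAlgebra k n ω γ ⊗[k] LiuAlgebra k n ω γ} {r : k}
    (ht : LinearMap.mul' k _ (antipodeₗ.lTensor _ t) = algebraMap k _ r)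
    (s : LiuAlgebra k n ω γ ⊗[k] LiuAlgebra k n ω γ) :
    LinearMap.mul' k _ (antipodeₗ.lTensor _ (s * t)) =
      r • LinearMap.mul' k _ (antipodeₗ.lTensor _ s) := by
  induction s with
  | zero => simp
  | add x y hx hy => simp only [add_mul, map_add, hx, hy, smul_add]
  | tmul a b =>
    have key : LinearMap.mul' k _ (antipodeₗ.lTensor _ (a ⊗ₜ b * t)) =
        a * LinearMap.mul' k _ (antipodeₗ.lTensor _ t) * antipodeₗ b := by
      clear ht
      induction t with
      | zero => simp
      | add x y hx hy => simp only [add_mul, map_add, hx, hy, mul_add]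
      | tmul c d => simp [antipodeₗ_mul, mul_assoc]
    rw [key, ht, ← Algebra.commutes, Algebra.algebraMap_eq_smul_one]
    simp

instance : HopfAlgebra k (LiuAlgebra k n ω γ) where
  antipode := antipodeₗ
  mul_antipode_rTensor_comul := by
    refine LinearMap.ext fun a => ?_
    change LinearMap.mul' k _ (antipodeₗ.rTensor _ (comulAlgHom a)) =
      algebraMap k _ (counitAlgHom a)
    induction a using induction with
    | hgen i =>
      cases i <;> simp [comulAlgHom_gen, comulGen, counitAlgHom_gen, counitGen, antipodeₗ_gen,
        antipodeGen, antipodeₗ_one, x_mul_xinv, xinv_mul_x, ginv_mul_g, ginv_mul_y,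
        hγ.out.ne_zero (NeZero.ne n), smul_smul, mul_assoc]
    | hmap r => simp [Algebra.TensorProduct.algebraMap_apply, antipodeₗ_algebraMap]
    | hadd a b ha hb => simp only [map_add, ha, hb]
    | hmul a b ha hb =>
      rw [map_mul, mul_rTensor_antipodeₗ ha, hb, map_mul, map_mul, Algebra.smul_def]
  mul_antipode_lTensor_comul := by
    refine LinearMap.ext fun a => ?_
    change LinearMap.mul' k _ (antipodeₗ.lTensor _ (comulAlgHom a)) =
      algebraMap k _ (counitAlgHom a)
    induction a using induction with
    | hgen i =>
      cases i <;> simp [comulAlgHom_gen, comulGen, counitAlgHom_gen, counitGen, antipodeₗ_gen,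
        antipodeGen, x_mul_xinv, xinv_mul_x, g_mul_ginv, ginv_mul_y,
        hγ.out.ne_zero (NeZero.ne n), smul_smul]
    | hmap r => simp [Algebra.TensorProduct.algebraMap_apply, antipodeₗ_one]
    | hadd a b ha hb => simp only [map_add, ha, hb]
    | hmul a b ha hb =>
      rw [map_mul, mul_lTensor_antipodeₗ hb, ha, map_mul, map_mul, Algebra.smul_def, Algebra.commutes]

end

end LiuAlgebra

/-- The Hopf algebra structures on a given algebra `A` over `k`, compatible with the algebra
structure of `A`. -/
structure HopfStructure (k A : Type*) [Field k] [Ring A] [Algebra k A] where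
  /-- The comultiplication. -/
  comul : A →ₐ[k] A ⊗[k] A
  /-- The counit. -/
  counit : A →ₐ[k] k
  /-- The antipode. -/
  antipode : A →ₗ[k] A
  coassoc : (Algebra.TensorProduct.assoc k k k A A A).toAlgHom.comp
      ((Algebra.TensorProduct.map comul (.id k A)).comp comul) =
    (Algebra.TensorProduct.map (.id k A) comul).comp comul
  rTensor_counit_comp_comul : (Algebra.TensorProduct.map counit (.id k A)).comp comul =
    (Algebra.TensorProduct.lid k A).symm
  lTensor_counit_comp_comul : (Algebra.TensorProduct.map (.id k A) counit).comp comul =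
    (Algebra.TensorProduct.rid k k A).symm
  mul_antipode_rTensor_comul : LinearMap.mul' k A ∘ₗ antipode.rTensor A ∘ₗ comul.toLinearMap =
    Algebra.linearMap k A ∘ₗ counit.toLinearMap
  mul_antipode_lTensor_comul : LinearMap.mul' k A ∘ₗ antipode.lTensor A ∘ₗ comul.toLinearMap =
    Algebra.linearMap k A ∘ₗ counit.toLinearMap

/-- The Hopf algebra given by a Hopf algebra structure. -/
abbrev HopfStructure.toHopfAlgebra {k A : Type*} [Field k] [Ring A] [Algebra k A]
    (𝓗 : HopfStructure k A) : HopfAlgebra k A :=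
  { Bialgebra.ofAlgHom 𝓗.comul 𝓗.counit 𝓗.coassoc 𝓗.rTensor_counit_comp_comul
      𝓗.lTensor_counit_comp_comul with
    antipode := 𝓗.antipode
    mul_antipode_rTensor_comul := 𝓗.mul_antipode_rTensor_comul
    mul_antipode_lTensor_comul := 𝓗.mul_antipode_lTensor_comul }

/-- The group of pairs `(α, β)` of nonzero scalars with `α ^ ω = β ^ n`. -/
def RootPair (k : Type*) [Field k] (n ω : ℕ) : Subgroup (kˣ × kˣ) where
  carrier := {p | p.1 ^ ω = p.2 ^ n}
  one_mem' := by simp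
  mul_mem' := by
    intro p q hp hq
    simp only [Set.mem_ofPred_eq] at hp hq
    simp [mul_pow, hp, hq]
  inv_mem' := by
    intro p hp
    simp only [Set.mem_ofPred_eq] at hp
    simp [hp]

/-- The pair `(1, γ)`. -/
def RootPair.one_root {k : Type*} [Field k] (n ω : ℕ) (γ : k) [NeZero n]
    [hγ : Fact (IsPrimitiveRoot γ n)] : RootPair k n ω :=
  ⟨(1, (hγ.out.isUnit (NeZero.ne n)).unit), by
    change (1 : kˣ) ^ ω = (hγ.out.isUnit (NeZero.ne n)).unit ^ n
    ext
    simp [hγ.out.pow_eq_one]⟩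

/-- The generators `Ψ_{α,β}` (with `α ^ ω = β ^ n`), `F₁`, `F₂` of `B_∘(n, ω, γ)`. -/
inductive LiuDual.Gen (k : Type*) [Field k] (n ω : ℕ)
  | Ψ (p : RootPair k n ω)
  | F₁
  | F₂

open LiuDual.Gen FreeAlgebra in
/-- The defining relations of `B_∘(n, ω, γ)`. -/
inductive LiuDual.Rel (k : Type*) [Field k] (n ω : ℕ) :
    FreeAlgebra k (LiuDual.Gen k n ω) → FreeAlgebra k (LiuDual.Gen k n ω) → Prop
  | Ψ_mul_Ψ (p q : RootPair k n ω) : Rel k n ω (ι k (Ψ p) * ι k (Ψ q)) (ι k (Ψ (p * q)))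
  | Ψ_one : Rel k n ω (ι k (Ψ 1)) 1
  | F₁_pow : Rel k n ω (ι k F₁ ^ n) 0
  | F₂_mul_Ψ (p : RootPair k n ω) : Rel k n ω (ι k F₂ * ι k (Ψ p)) (ι k (Ψ p) * ι k F₂)
  | F₁_mul_Ψ (p : RootPair k n ω) :
      Rel k n ω (ι k F₁ * ι k (Ψ p)) ((p.1.2 : k) • (ι k (Ψ p) * ι k F₁))
  | F₁_mul_F₂ : Rel k n ω (ι k F₁ * ι k F₂) (ι k F₂ * ι k F₁ + (1 / (n : k)) • ι k F₁)

/-- The algebra `B_∘(n, ω, γ)`, by generators and relations. The relations do not involve `γ`; the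
root of unity `γ` enters the Hopf algebra structure only. -/
def LiuDual (k : Type*) [Field k] (n ω : ℕ) : Type _ :=
  RingQuot (LiuDual.Rel k n ω)

namespace LiuDual

open TensorProduct

variable {k : Type*} [Field k] {n ω : ℕ}

instance : Ring (LiuDual k n ω) := inferInstanceAs (Ring (RingQuot (Rel k n ω)))

instance : Algebra k (LiuDual k n ω) := inferInstanceAs (Algebra k (RingQuot (Rel k n ω)))

/-- The generator `Ψ_{α,β}`. -/
def Ψ (p : RootPair k n ω) : LiuDual k n ω :=
  RingQuot.mkAlgHom k (Rel k n ω) (FreeAlgebra.ι k (Gen.Ψ p))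

/-- The generator `F₁`. -/
def F₁ : LiuDual k n ω := RingQuot.mkAlgHom k (Rel k n ω) (FreeAlgebra.ι k Gen.F₁)

/-- The generator `F₂`. -/
def F₂ : LiuDual k n ω := RingQuot.mkAlgHom k (Rel k n ω) (FreeAlgebra.ι k Gen.F₂)

/-- The quantum factorial `m!_γ = 1_γ 2_γ ⋯ m_γ` with `i_γ = 1 + γ + ⋯ + γ ^ (i - 1)`. -/
def qFactorial (γ : k) (m : ℕ) : k :=
  ∏ i ∈ Finset.Icc 1 m, ∑ j ∈ Finset.range i, γ ^ j

/-- The divided power `F₁^[m] = F₁ ^ m / m!_γ`. -/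
def dividedF₁ (γ : k) (m : ℕ) : LiuDual k n ω := (qFactorial γ m)⁻¹ • F₁ ^ m

/-- The element `∑_{1 ≤ m ≤ n - 1} F₁^[m] ⊗ Ψ_{1,γ} ^ m F₁^[n - m]`. -/
def crossTerm (γ : k) [NeZero n] [Fact (IsPrimitiveRoot γ n)] :
    LiuDual k n ω ⊗[k] LiuDual k n ω :=
  ∑ m ∈ Finset.Ico 1 n,
    dividedF₁ γ m ⊗ₜ[k] (Ψ (RootPair.one_root n ω γ) ^ m * dividedF₁ γ (n - m))

end LiuDual

end

/-!
Write `B = B(n, ω, γ)`. The algebra `B` is spanned by the monomials `x ^ i g ^ j y ^ l` with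
`i j : ℤ` and `l < n` (`LiuAlgebra.span_mon`), so an element of `B°` is determined by the function
of `(i, j, l)` that it induces. In these coordinates the convolution product is
`(f f')(i, j, l) = ∑ m, (l choose m)_γ f(i, j, m) f'(i, j + m, l - m)`, and the comultiplication is
read off from `y ^ l g ^ j = γ ^ (l j) g ^ j y ^ l` and `y ^ n = 1 - x ^ ω`.

Put `χ(i, j) = α ^ i β ^ j` and `λ(i, j) = i / ω + j / n`. The generators correspond to the forms
`Ψ_{α,β} = χ(i, j) δ_{l,0}`, `F₁ = δ_{l,1}` and `F₂ = λ(i, j) δ_{l,0}`. All three are matrix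
coefficients of one family of finite-dimensional representations, on the sequences in a commutative
algebra `R` with `f (l + n) = (1 - a ^ ω) f l`. Here `R = k`, except for `F₂`, where `R` is the
algebra of dual numbers: `F₂` is the `ε`-part of `Ψ` at `(1 + ε / ω, 1 + ε / n)`. The relations of
`B_∘` hold by comparison of coordinates, which gives `LiuDual.toFiniteDual : B_∘ → B°`. It sends
`Ψ_{α,β} P(F₂) F₁ ^ m` to `m!_γ χ P(λ) δ_{l,m}`.

* Injectivity: the elements `Ψ_{α,β} P(F₂) F₁ ^ m` with `m < n` span `B_∘`
  (`LiuDual.exists_eq_sum_normalForm`), and the functions `χ P(λ)` on `ℤ × ℤ` for distinct `χ` are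
  independent, being generalized simultaneous eigenvectors of the two shifts
  (`LiuDual.eq_zero_of_sum_expPoly_eq_zero`).
* Surjectivity: a form in `B°` factors through a finite-dimensional quotient `A`. For fixed `l` its
  coordinate function is a matrix coefficient of the commuting units `x`, `g` with `x ^ ω = g ^ n`
  acting on `A`. Since `k` is algebraically closed, `A` is a sum of generalized simultaneous
  eigenspaces, and on each of them the coefficient is of the form `χ P(λ)`, by induction on the
  order of nilpotency: a function invariant under `(ω, -n)` with discrete derivatives polynomial
  in `λ` is polynomial in `λ` (`LiuDual.exists_eq_eval_linChar`,
  `LiuDual.exists_apply_eq_sum_expPoly`).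

The Hopf algebra structure of `B_∘` is the one transported from `B°` along this isomorphism, and the
stated formulas are the coordinate computations of `Δ` and `S` on the three forms.
-/

noncomputable section

/-! ### Monomials of the generalized Liu algebra -/

namespace LiuAlgebra

variable {k : Type*} [Field k] {n ω : ℕ} {γ : k}

/-- The generator `x` as a unit. -/
def xUnit : (LiuAlgebra k n ω γ)ˣ := ⟨gen .x, gen .xinv, x_mul_xinv, xinv_mul_x⟩

theorem y_pow_mul_xUnit_zpow (l : ℕ) (i : ℤ) :
    (gen .y : LiuAlgebra k n ω γ) ^ l * ((xUnit ^ i : (LiuAlgebra k n ω γ)ˣ) : LiuAlgebra k n ω γ) =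
      ((xUnit ^ i : (LiuAlgebra k n ω γ)ˣ) : LiuAlgebra k n ω γ) * gen .y ^ l := by
  have h : Commute (gen .y ^ l : LiuAlgebra k n ω γ) (xUnit : (LiuAlgebra k n ω γ)ˣ) :=
    Commute.pow_left (show Commute (gen .y) (gen .x) from x_mul_y.symm) l
  exact (Commute.units_zpow_right h i).eq

theorem y_pow_mul_g (l : ℕ) :
    (gen .y : LiuAlgebra k n ω γ) ^ l * gen .g = γ ^ l • (gen .g * gen .y ^ l) := by
  induction l with
  | zero => simp
  | succ l ih =>
    rw [pow_succ, mul_assoc, y_mul_g, mul_smul_comm, ← mul_assoc, ih, smul_mul_assoc, smul_smul,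
      mul_assoc, ← pow_succ, ← pow_succ']

variable [NeZero n]

/-- The generator `g` as a unit. -/
def gUnit : (LiuAlgebra k n ω γ)ˣ := ⟨gen .g, ginv, g_mul_ginv, ginv_mul_g⟩

/-- The monomial `x ^ i g ^ j y ^ l`, with integral exponents of `x` and `g`. -/
def mon (i j : ℤ) (l : ℕ) : LiuAlgebra k n ω γ :=
  ((xUnit ^ i * gUnit ^ j : (LiuAlgebra k n ω γ)ˣ) : LiuAlgebra k n ω γ) * gen .y ^ l

theorem xUnit_commute_gUnit : Commute (xUnit : (LiuAlgebra k n ω γ)ˣ) gUnit :=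
  Units.ext x_mul_g

theorem gUnit_pow : (gUnit : (LiuAlgebra k n ω γ)ˣ) ^ n = xUnit ^ ω := Units.ext g_pow

theorem mon_zero : mon (n := n) (ω := ω) (γ := γ) 0 0 0 = 1 := by simp [mon]

theorem y_pow_mul_gUnit_zpow (hγ : γ ≠ 0) (l : ℕ) (j : ℤ) :
    (gen .y : LiuAlgebra k n ω γ) ^ l * ((gUnit ^ j : (LiuAlgebra k n ω γ)ˣ) : LiuAlgebra k n ω γ) =
      (γ ^ j) ^ l • (((gUnit ^ j : (LiuAlgebra k n ω γ)ˣ) : LiuAlgebra k n ω γ) * gen .y ^ l) := by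
  induction j with
  | zero => simp
  | succ j ih =>
    rw [zpow_add_one, Units.val_mul, ← mul_assoc, ih, smul_mul_assoc, mul_assoc,
      show ((gUnit : (LiuAlgebra k n ω γ)ˣ) : LiuAlgebra k n ω γ) = gen .g from rfl,
      y_pow_mul_g, mul_smul_comm, smul_smul, ← mul_assoc, zpow_add_one₀ hγ, mul_pow]
  | pred j ih =>
    rw [← Units.mul_left_inj gUnit, mul_assoc, ← Units.val_mul, ← zpow_add_one, sub_add_cancel, ih,
      smul_mul_assoc, mul_assoc,
      show ((gUnit : (LiuAlgebra k n ω γ)ˣ) : LiuAlgebra k n ω γ) = gen .g from rfl,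
      y_pow_mul_g, mul_smul_comm, smul_smul, ← mul_assoc, zpow_sub_one₀ hγ, mul_pow, mul_assoc,
      ← mul_pow, inv_mul_cancel₀ hγ, one_pow, mul_one, zpow_sub_one, Units.val_mul,
      mul_assoc _ _ (gen .g), show ((gUnit⁻¹ : (LiuAlgebra k n ω γ)ˣ) : LiuAlgebra k n ω γ) = ginv
      from rfl, ginv_mul_g, mul_one]

theorem mon_mul_mon (hγ : γ ≠ 0) (i j i' j' : ℤ) (l l' : ℕ) :
    (mon i j l : LiuAlgebra k n ω γ) * mon i' j' l' =
      (γ ^ j') ^ l • mon (i + i') (j + j') (l + l') := by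
  simp only [mon]
  rw [show (xUnit ^ (i + i') * gUnit ^ (j + j') : (LiuAlgebra k n ω γ)ˣ) =
      xUnit ^ i * gUnit ^ j * (xUnit ^ i' * gUnit ^ j') by
    rw [zpow_add, zpow_add, mul_assoc, mul_assoc, ← mul_assoc (xUnit ^ i') (gUnit ^ j),
      ((xUnit_commute_gUnit.zpow_left i').zpow_right j).eq, mul_assoc]]
  rw [Units.val_mul (xUnit ^ i * gUnit ^ j), Units.val_mul (xUnit ^ i') (gUnit ^ j'), pow_add,
    mul_assoc, ← mul_assoc (gen .y ^ l), ← mul_assoc (gen .y ^ l), y_pow_mul_xUnit_zpow,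
    mul_assoc (_ : LiuAlgebra k n ω γ) (gen .y ^ l), y_pow_mul_gUnit_zpow hγ]
  simp only [mul_smul_comm, smul_mul_assoc, mul_assoc]

theorem mon_add_n (i j : ℤ) (l : ℕ) :
    (mon i j (l + n) : LiuAlgebra k n ω γ) = mon i j l - mon (i + ω) j l := by
  have h : (gen .x : LiuAlgebra k n ω γ) ^ ω =
      ((xUnit ^ (ω : ℤ) : (LiuAlgebra k n ω γ)ˣ) : LiuAlgebra k n ω γ) := by
    rw [zpow_natCast]; rfl
  simp only [mon]
  rw [pow_add, y_pow, mul_sub, mul_one, mul_sub, h, y_pow_mul_xUnit_zpow, zpow_add,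
    mul_assoc (xUnit ^ i), ((xUnit_commute_gUnit.zpow_left ω).zpow_right j).eq,
    ← mul_assoc (xUnit ^ i), Units.val_mul (xUnit ^ i * gUnit ^ j), mul_assoc]

theorem x_eq_mon : (gen .x : LiuAlgebra k n ω γ) = mon 1 0 0 := by simp [mon, xUnit]
theorem xinv_eq_mon : (gen .xinv : LiuAlgebra k n ω γ) = mon (-1) 0 0 := by simp [mon, xUnit]
theorem g_eq_mon : (gen .g : LiuAlgebra k n ω γ) = mon 0 1 0 := by simp [mon, gUnit]
theorem y_eq_mon : (gen .y : LiuAlgebra k n ω γ) = mon 0 0 1 := by simp [mon]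
theorem ginv_eq_mon : (ginv : LiuAlgebra k n ω γ) = mon 0 (-1) 0 := by simp [mon, gUnit]

theorem mon_mem_span (i j : ℤ) (l : ℕ) : (mon i j l : LiuAlgebra k n ω γ) ∈
    Submodule.span k {a | ∃ i j : ℤ, ∃ l < n, a = mon i j l} := by
  induction l using Nat.strong_induction_on generalizing i j with
  | _ l ih =>
    rcases lt_or_ge l n with h | h
    · exact Submodule.subset_span ⟨i, j, l, h, rfl⟩
    · obtain ⟨m, rfl⟩ := Nat.exists_eq_add_of_le' h
      have := NeZero.pos n
      rw [mon_add_n]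
      exact sub_mem (ih m (by omega) _ _) (ih m (by omega) _ _)

/-- The monomials `x ^ i g ^ j y ^ l` with `l < n` span `B(n, ω, γ)`. -/
theorem span_mon (hγ : γ ≠ 0) : Submodule.span k
    {a : LiuAlgebra k n ω γ | ∃ i j : ℤ, ∃ l < n, a = mon i j l} = ⊤ := by
  set S := Submodule.span k {a : LiuAlgebra k n ω γ | ∃ i j : ℤ, ∃ l < n, a = mon i j l}
  have key : ∀ a : LiuAlgebra k n ω γ, ∀ b ∈ S, a * b ∈ S := by
    have hmon : ∀ (i j : ℤ) (l : ℕ), ∀ b ∈ S, mon i j l * b ∈ S := by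
      intro i j l b hb
      induction hb using Submodule.span_induction with
      | mem b hb =>
        obtain ⟨i', j', l', -, rfl⟩ := hb
        rw [mon_mul_mon hγ]
        exact S.smul_mem _ (mon_mem_span _ _ _)
      | zero => simp
      | add a b _ _ ha hb => rw [mul_add]; exact S.add_mem ha hb
      | smul c a _ ha => rw [mul_smul_comm]; exact S.smul_mem _ ha
    intro a
    induction a using induction with
    | hgen i =>
      cases i
      · rw [x_eq_mon]; exact hmon _ _ _
      · rw [xinv_eq_mon]; exact hmon _ _ _
      · rw [g_eq_mon]; exact hmon _ _ _
      · rw [y_eq_mon]; exact hmon _ _ _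
    | hmap r => intro b hb; rw [← Algebra.smul_def]; exact S.smul_mem _ hb
    | hadd a b ha hb => intro c hc; rw [add_mul]; exact S.add_mem (ha c hc) (hb c hc)
    | hmul a b ha hb => intro c hc; rw [mul_assoc]; exact ha _ (hb c hc)
  refine eq_top_iff.2 fun a _ => ?_
  have := key a 1 (by rw [← mon_zero]; exact mon_mem_span _ _ _)
  rwa [mul_one] at this

end LiuAlgebra

/-! ### Coordinates on the finite dual -/

namespace LiuAlgebra

variable {k : Type*} [Field k] {n ω : ℕ} {γ : k} [NeZero n] [hγ : Fact (IsPrimitiveRoot γ n)]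

theorem root_ne_zero (n : ℕ) [NeZero n] (γ : k) [hγ : Fact (IsPrimitiveRoot γ n)] : γ ≠ 0 :=
  hγ.out.ne_zero (NeZero.ne n)

/-- The monoid homomorphism `a ↦ a ⊗ a`. -/
def diag : LiuAlgebra k n ω γ →* LiuAlgebra k n ω γ ⊗[k] LiuAlgebra k n ω γ where
  toFun a := a ⊗ₜ a
  map_one' := rfl
  map_mul' a b := by simp

theorem comul_mon_zero (i j : ℤ) : Coalgebra.comul (R := k) (mon i j 0 : LiuAlgebra k n ω γ) =
    mon i j 0 ⊗ₜ mon i j 0 := by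
  let c : LiuAlgebra k n ω γ →* LiuAlgebra k n ω γ ⊗[k] LiuAlgebra k n ω γ :=
    (comulAlgHom : LiuAlgebra k n ω γ →ₐ[k] _)
  have hx : Units.map c xUnit = Units.map diag xUnit := Units.ext (comulAlgHom_gen .x)
  have hg : Units.map c gUnit = Units.map diag gUnit := Units.ext (comulAlgHom_gen .g)
  have h : Units.map c (xUnit ^ i * gUnit ^ j) = Units.map diag (xUnit ^ i * gUnit ^ j) := by
    simp only [map_mul, map_zpow, hx, hg]
  have hm : (mon i j 0 : LiuAlgebra k n ω γ) =
      ((xUnit ^ i * gUnit ^ j : (LiuAlgebra k n ω γ)ˣ) : LiuAlgebra k n ω γ) := by simp [mon]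
  rw [hm]
  exact congrArg Units.val h

theorem comul_y : Coalgebra.comul (R := k) (gen .y : LiuAlgebra k n ω γ) =
    1 ⊗ₜ gen .y + gen .y ⊗ₜ gen .g := comulAlgHom_gen .y

theorem comul_mon (i j : ℤ) (l : ℕ) : Coalgebra.comul (R := k) (mon i j l : LiuAlgebra k n ω γ) =
    ∑ m ∈ Finset.range (l + 1), (qChoose γ l m • mon i j m) ⊗ₜ mon i (j + m) (l - m) := by
  have hm : ∀ l, (mon i j l : LiuAlgebra k n ω γ) = mon i j 0 * gen .y ^ l := by simp [mon]
  have hg : ∀ m : ℕ, (gen .g : LiuAlgebra k n ω γ) ^ m = mon 0 m 0 := by simp [mon, gUnit]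
  have hy : ∀ m : ℕ, (gen .y : LiuAlgebra k n ω γ) ^ m = mon 0 0 m := by simp [mon]
  have h : (1 : LiuAlgebra k n ω γ) ⊗ₜ[k] (gen .y : LiuAlgebra k n ω γ) * (gen .y ⊗ₜ gen .g) =
      γ • ((gen .y : LiuAlgebra k n ω γ) ⊗ₜ[k] (gen .g : LiuAlgebra k n ω γ) * (1 ⊗ₜ gen .y)) := by
    simp [y_mul_g]
  rw [hm, Bialgebra.comul_mul, Bialgebra.comul_pow, comul_mon_zero, comul_y,
    add_pow_of_mul_eq_smul γ h, Finset.mul_sum]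
  refine Finset.sum_congr rfl fun m _ => ?_
  simp only [Algebra.TensorProduct.tmul_pow, Algebra.TensorProduct.tmul_mul_tmul, mul_smul_comm,
    TensorProduct.smul_tmul', hg, hy, one_pow, mul_one, mon_mul_mon (root_ne_zero n γ)]
  simp

theorem counit_mon (i j : ℤ) (l : ℕ) : Coalgebra.counit (R := k) (mon i j l : LiuAlgebra k n ω γ) =
    if l = 0 then 1 else 0 := by
  let c : LiuAlgebra k n ω γ →* k := (counitAlgHom : LiuAlgebra k n ω γ →ₐ[k] _)
  have hx : Units.map c xUnit = 1 := Units.ext (counitAlgHom_gen .x)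
  have hg : Units.map c gUnit = 1 := Units.ext (counitAlgHom_gen .g)
  have h : Units.map c (xUnit ^ i * gUnit ^ j) = 1 := by
    simp only [map_mul, map_zpow, hx, hg, one_zpow, mul_one]
  have h' : counitAlgHom
      ((xUnit ^ i * gUnit ^ j : (LiuAlgebra k n ω γ)ˣ) : LiuAlgebra k n ω γ) = 1 :=
    congrArg Units.val h
  change counitAlgHom (mon i j l) = _
  rw [mon, map_mul, h', map_pow, counitAlgHom_gen, counitGen, zero_pow_eq, one_mul]

theorem antipode_mon_zero (i j : ℤ) :
    HopfAlgebra.antipode k (mon i j 0 : LiuAlgebra k n ω γ) = mon (-i) (-j) 0 := by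
  have h := HopfAlgebra.mul_antipode_lTensor_comul_apply (R := k) (mon i j 0 : LiuAlgebra k n ω γ)
  rw [comul_mon_zero, counit_mon] at h
  simp only [LinearMap.lTensor_tmul, LinearMap.mul'_apply, if_true, map_one] at h
  calc _ = (mon (-i) (-j) 0 * mon i j 0) *
          HopfAlgebra.antipode k (mon i j 0 : LiuAlgebra k n ω γ) := by
        rw [mon_mul_mon (root_ne_zero n γ)]; simp [mon_zero]
    _ = _ := by rw [mul_assoc, h, mul_one]

theorem antipode_y : HopfAlgebra.antipode k (gen .y : LiuAlgebra k n ω γ) =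
    -(γ⁻¹ • mon 0 (-1) 1) := by
  refine (antipodeₗ_gen .y).trans ?_
  simp only [antipodeGen, MulOpposite.unop_op, ginv_eq_mon, y_eq_mon,
    mon_mul_mon (root_ne_zero n γ)]
  simp

theorem antipode_mul (a b : LiuAlgebra k n ω γ) : HopfAlgebra.antipode k (a * b) =
    HopfAlgebra.antipode k b * HopfAlgebra.antipode k a := antipodeₗ_mul a b

theorem antipode_mon_one (i j : ℤ) :
    HopfAlgebra.antipode k (mon i j 1 : LiuAlgebra k n ω γ) =
      -((γ ^ (j + 1))⁻¹ • mon (-i) (-j - 1) 1) := by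
  have hm : (mon i j 1 : LiuAlgebra k n ω γ) = mon i j 0 * gen .y := by simp [mon]
  have h0 := root_ne_zero n γ
  rw [hm, antipode_mul, antipode_mon_zero, antipode_y, neg_mul, smul_mul_assoc,
    mon_mul_mon (root_ne_zero n γ), smul_smul, zpow_add_one₀ h0]
  congr 2
  · rw [pow_one, zpow_neg, mul_inv, mul_comm]
  · congr 1 <;> ring

/-- The antipode preserves the `y`-degree of a monomial. -/
theorem exists_antipode_mon (i j : ℤ) (l : ℕ) : ∃ (c : k) (i' j' : ℤ),
    HopfAlgebra.antipode k (mon i j l : LiuAlgebra k n ω γ) = c • mon i' j' l := by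
  have h0 := root_ne_zero n γ
  induction l with
  | zero => exact ⟨1, -i, -j, by rw [antipode_mon_zero, one_smul]⟩
  | succ l ih =>
    obtain ⟨c, i', j', h⟩ := ih
    have hm : (mon i j (l + 1) : LiuAlgebra k n ω γ) = mon i j l * gen .y := by
      simp [mon, pow_succ, mul_assoc]
    rw [hm, antipode_mul, h, antipode_y, neg_mul, smul_mul_smul_comm, mon_mul_mon h0, smul_smul,
      ← neg_smul, add_comm 1 l]
    exact ⟨_, _, _, rfl⟩

theorem qChoose_one_right (l : ℕ) : qChoose γ l 1 = ∑ j ∈ Finset.range l, γ ^ j := by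
  induction l with
  | zero => rfl
  | succ l ih => rw [qChoose_succ_succ, qChoose_zero_right, ih, geom_sum_succ]; ring

end LiuAlgebra

namespace FiniteDual

variable {k : Type*} [Field k]

section

variable {H : Type*} [Ring H] [HopfAlgebra k H]

/-- Elements of `H°` are determined by their values on a spanning set. -/
theorem ext_span {S : Set H} (hS : Submodule.span k S = ⊤)
    {f g : FiniteDual k H} (hfg : ∀ h ∈ S, eval h f = eval h g) : f = g :=
  Subtype.ext (WithConv.ext (LinearMap.ext_on hS hfg))

/-- Elements of `H° ⊗ H°` are determined by the pairing with a spanning set. -/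
theorem ext_span₂ {S : Set H} (hS : Submodule.span k S = ⊤)
    {s t : FiniteDual k H ⊗[k] FiniteDual k H}
    (hst : ∀ h ∈ S, ∀ h' ∈ S, eval₂ h h' s = eval₂ h h' t) : s = t := by
  have hc : ∀ h ∈ S, contract (FiniteDual k H) h s = contract _ h t := fun h hh =>
    ext_span hS fun h' hh' => hst h hh h' hh'
  let C : H →ₗ[k] FiniteDual k H ⊗[k] FiniteDual k H →ₗ[k] FiniteDual k H :=
    { toFun := fun h => contract _ h
      map_add' := fun a b => by
        have : (eval (a + b) : FiniteDual k H →ₗ[k] k) = eval a + eval b :=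
          LinearMap.ext fun f => map_add f.1.ofConv a b
        rw [contract, this, LinearMap.rTensor_add, LinearMap.comp_add]; rfl
      map_smul' := fun c a => by
        have : (eval (c • a) : FiniteDual k H →ₗ[k] k) = c • eval a :=
          LinearMap.ext fun f => map_smul f.1.ofConv c a
        rw [contract, this, LinearMap.rTensor_smul, LinearMap.comp_smul]; rfl }
  have key : C.flip s = C.flip t := LinearMap.ext_on hS hc
  exact ext_contract fun h => LinearMap.congr_fun key h

end

open LiuAlgebra

variable {n ω : ℕ} {γ : k} [NeZero n] [hγ : Fact (IsPrimitiveRoot γ n)]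

theorem ext_mon {f g : FiniteDual k (LiuAlgebra k n ω γ)}
    (h : ∀ i j, ∀ l < n, eval (mon i j l) f = eval (mon i j l) g) : f = g := by
  refine ext_span (span_mon (root_ne_zero n γ)) ?_
  rintro _ ⟨i, j, l, hl, rfl⟩
  exact h i j l hl

theorem ext_mon₂ {s t : FiniteDual k (LiuAlgebra k n ω γ) ⊗[k] FiniteDual k (LiuAlgebra k n ω γ)}
    (h : ∀ i j, ∀ l < n, ∀ i' j', ∀ l' < n,
      eval₂ (mon i j l) (mon i' j' l') s = eval₂ (mon i j l) (mon i' j' l') t) : s = t := by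
  refine ext_span₂ (span_mon (root_ne_zero n γ)) ?_
  rintro _ ⟨i, j, l, hl, rfl⟩ _ ⟨i', j', l', hl', rfl⟩
  exact h i j l hl i' j' l' hl'

theorem eval_mon_one (i j : ℤ) (l : ℕ) :
    eval (mon i j l) (1 : FiniteDual k (LiuAlgebra k n ω γ)) = if l = 0 then 1 else 0 := by
  rw [eval_one, counit_mon]

/-- The convolution product in coordinates. -/
theorem eval_mon_mul (i j : ℤ) (l : ℕ) (f g : FiniteDual k (LiuAlgebra k n ω γ)) :
    eval (mon i j l) (f * g) = ∑ m ∈ Finset.range (l + 1),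
      qChoose γ l m * eval (mon i j m) f * eval (mon i (j + m) (l - m)) g := by
  let r : Coalgebra.Repr k (mon i j l : LiuAlgebra k n ω γ) ℕ :=
    { index := Finset.range (l + 1)
      left := fun m => qChoose γ l m • mon i j m
      right := fun m => mon i (j + m) (l - m)
      eq := (comul_mon i j l).symm }
  exact (eval_mul r f g).trans (Finset.sum_congr rfl fun m _ =>
    congrArg (· * _) (eval_smul (qChoose γ l m) (mon i j m) f))

/-- A form vanishing on monomials of positive `y`-degree multiplies pointwise from the left. -/
theorem eval_mon_mul_of_degree_zero {i j : ℤ} {l : ℕ} {f : FiniteDual k (LiuAlgebra k n ω γ)}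
    (hf : ∀ m, m ≠ 0 → m ≤ l → eval (mon i j m) f = 0) (g : FiniteDual k (LiuAlgebra k n ω γ)) :
    eval (mon i j l) (f * g) = eval (mon i j 0) f * eval (mon i j l) g := by
  rw [eval_mon_mul, Finset.sum_eq_single_of_mem 0 (by simp)]
  · simp [qChoose_zero_right]
  · intro m hm h0
    rw [hf m h0 (by have := Finset.mem_range.1 hm; omega), mul_zero, zero_mul]

/-- Left multiplication by a form supported in `y`-degree `1`. -/
theorem eval_mon_mul_of_degree_one {i j : ℤ} {l : ℕ} {f : FiniteDual k (LiuAlgebra k n ω γ)}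
    (hf : ∀ m, m ≠ 1 → m ≤ l + 1 → eval (mon i j m) f = 0)
    (g : FiniteDual k (LiuAlgebra k n ω γ)) :
    eval (mon i j (l + 1)) (f * g) = (∑ r ∈ Finset.range (l + 1), γ ^ r) *
      eval (mon i j 1) f * eval (mon i (j + 1) l) g := by
  rw [eval_mon_mul, Finset.sum_eq_single_of_mem 1 (by simp)]
  · simp [qChoose_one_right]
  · intro m hm h0
    rw [hf m h0 (by have := Finset.mem_range.1 hm; omega), mul_zero, zero_mul]

theorem eval₂_comul_mon (i j : ℤ) (l : ℕ) (i' j' : ℤ) (l' : ℕ)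
    (f : FiniteDual k (LiuAlgebra k n ω γ)) :
    eval₂ (mon i j l) (mon i' j' l') (Coalgebra.comul (R := k) f) =
      (γ ^ j') ^ l * eval (mon (i + i') (j + j') (l + l')) f := by
  rw [eval₂_comul, mon_mul_mon (root_ne_zero n γ), eval_smul, smul_eq_mul]

theorem eval_mon_add_n (i j : ℤ) (l : ℕ) (f : FiniteDual k (LiuAlgebra k n ω γ)) :
    eval (mon i j (l + n)) f = eval (mon i j l) f - eval (mon (i + ω) j l) f := by
  rw [mon_add_n]
  exact map_sub f.1.ofConv _ _

end FiniteDual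

/-! ### Matrix coefficients on quasi-periodic sequences -/

/-- The sequences `f` in `R` with `f (l + n) = c * f l`. -/
def quasiPeriodic (k : Type*) [Field k] {R : Type*} [CommRing R] [Algebra k R] (n : ℕ) (c : R) :
    Submodule k (ℕ → R) where
  carrier := {f | ∀ l, f (l + n) = c * f l}
  add_mem' hf hg l := by simp [hf l, hg l, mul_add]
  zero_mem' l := by simp
  smul_mem' r f hf l := by simp [hf l]

namespace quasiPeriodic

variable {k : Type*} [Field k] {R : Type*} [CommRing R] [Algebra k R] {n : ℕ} {c : R}

instance finiteDimensional [NeZero n] [FiniteDimensional k R] :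
    FiniteDimensional k (quasiPeriodic k n c) := by
  let r : quasiPeriodic k n c →ₗ[k] (Fin n → R) :=
    { toFun := fun f i => f.1 i
      map_add' := fun _ _ => rfl
      map_smul' := fun _ _ => rfl }
  refine Module.Finite.of_injective r fun f g h => Subtype.ext (funext fun l => ?_)
  induction l using Nat.strong_induction_on with
  | _ l ih =>
    rcases lt_or_ge l n with hl | hl
    · exact congrFun h ⟨l, hl⟩
    · obtain ⟨m, rfl⟩ := Nat.exists_eq_add_of_le' hl
      rw [f.2 m, g.2 m, ih m (by have := NeZero.pos n; omega)]

variable (k n c) in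
/-- Evaluation at `0`. -/
def evalZero : quasiPeriodic k n c →ₗ[k] R where
  toFun f := f.1 0
  map_add' _ _ := rfl
  map_smul' _ _ := rfl

variable (k n c) in
/-- Termwise multiplication by `a * q ^ l`, where `q ^ n = 1`. -/
def scale (a : R) (q : k) (hq : q ^ n = 1) : Module.End k (quasiPeriodic k n c) where
  toFun f := ⟨fun l => a * (q ^ l • f.1 l), fun l => by
    beta_reduce
    rw [f.2 l, pow_add, hq, mul_one, Algebra.smul_def, Algebra.smul_def]
    ring⟩
  map_add' f g := Subtype.ext (funext fun l => by simp [mul_add])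
  map_smul' r f := Subtype.ext (funext fun l => by simp [smul_comm r])

variable (k n c) in
/-- The shift of a sequence. -/
def shift : Module.End k (quasiPeriodic k n c) where
  toFun f := ⟨fun l => f.1 (l + 1), fun l => by rw [← f.2 (l + 1), add_right_comm]⟩
  map_add' _ _ := rfl
  map_smul' _ _ := rfl

theorem scale_apply (a : R) (q : k) (hq : q ^ n = 1) (f : quasiPeriodic k n c) (l : ℕ) :
    (scale k n c a q hq f).1 l = a * (q ^ l • f.1 l) := rfl

theorem shift_apply (f : quasiPeriodic k n c) (l : ℕ) : (shift k n c f).1 l = f.1 (l + 1) := rfl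

theorem shift_pow_apply (m : ℕ) (f : quasiPeriodic k n c) (l : ℕ) :
    ((shift k n c ^ m) f).1 l = f.1 (l + m) := by
  induction m generalizing l with
  | zero => rfl
  | succ m ih =>
    rw [pow_succ', Module.End.mul_apply, shift_apply, ih, add_assoc, add_comm 1 m]

theorem scale_pow_apply (a : R) (q : k) (hq : q ^ n = 1) (m : ℕ) (f : quasiPeriodic k n c)
    (l : ℕ) : ((scale k n c a q hq ^ m) f).1 l = a ^ m * ((q ^ m) ^ l • f.1 l) := by
  induction m with
  | zero => simp
  | succ m ih =>
    rw [pow_succ', Module.End.mul_apply, scale_apply, ih, pow_succ' q, mul_pow, mul_smul, pow_succ']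
    simp only [Algebra.smul_def]
    ring

end quasiPeriodic

/-- The matrix coefficient `h ↦ e (ρ h v)` of a finite-dimensional representation `ρ`. -/
def FiniteDual.matrixCoeff {k H V : Type*} [Field k] [Ring H] [HopfAlgebra k H] [AddCommGroup V]
    [Module k V] [FiniteDimensional k V] (ρ : H →ₐ[k] Module.End k V) (v : V) (e : V →ₗ[k] k) :
    FiniteDual k H :=
  ⟨WithConv.toConv (e ∘ₗ LinearMap.applyₗ v ∘ₗ ρ.toLinearMap),
    FiniteDual.IsCofinite.of_factor (A := Module.End k V) ρ (e ∘ₗ LinearMap.applyₗ v) _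
      fun _ => rfl⟩

theorem FiniteDual.eval_matrixCoeff {k H V : Type*} [Field k] [Ring H] [HopfAlgebra k H]
    [AddCommGroup V] [Module k V] [FiniteDimensional k V] (ρ : H →ₐ[k] Module.End k V) (v : V)
    (e : V →ₗ[k] k) (h : H) : eval h (matrixCoeff ρ v e) = e (ρ h v) := rfl

namespace LiuAlgebra

open quasiPeriodic

variable {k : Type*} [Field k] {n ω : ℕ} {γ : k} {R : Type*} [CommRing R] [Algebra k R]

variable (k n) in
/-- The action of the generators on sequences with `f (l + n) = (1 - a ^ ω) f l`: here `x` acts by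
`a`, `g` by `b γ ^ l`, and `y` by the shift. -/
def seqGen (a b : Rˣ) (c : R) (hγ : γ ^ n = 1) : Gen → Module.End k (quasiPeriodic k n c)
  | .x => scale k n c a 1 (one_pow n)
  | .xinv => scale k n c (a⁻¹ : Rˣ) 1 (one_pow n)
  | .g => scale k n c b γ hγ
  | .y => shift k n c

theorem respects_seqGen {a b : Rˣ} (hab : a ^ ω = b ^ n) {c : R} (hc : c = 1 - (a : R) ^ ω)
    (hγ : γ ^ n = 1) : Respects n ω γ (seqGen k n a b c hγ) := by
  have hab' : (a : R) ^ ω = (b : R) ^ n := by exact_mod_cast congrArg Units.val hab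
  constructor <;> refine LinearMap.ext fun f => Subtype.ext (funext fun l => ?_)
  · simp [seqGen, scale_apply]
  · simp [seqGen, scale_apply]
  · simp [seqGen, scale_apply, mul_left_comm]
  · simp [seqGen, scale_apply, shift_apply]
  · simp [seqGen, scale_apply, shift_apply, pow_succ', mul_smul]
  · simp only [seqGen, shift_pow_apply, f.2 l, hc, LinearMap.sub_apply, Module.End.one_apply,
      Submodule.coe_sub, Pi.sub_apply, scale_pow_apply, one_pow, one_smul]
    ring
  · simp only [seqGen, LinearMap.sub_apply, Module.End.one_apply,
      Submodule.coe_sub, Pi.sub_apply, scale_pow_apply, one_pow, one_smul, hγ, hab']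

/-- The representation of `B(n, ω, γ)` on quasi-periodic sequences. -/
def seqRep {a b : Rˣ} (hab : a ^ ω = b ^ n) (hγ : γ ^ n = 1) :
    LiuAlgebra k n ω γ →ₐ[k] Module.End k (quasiPeriodic k n (1 - (a : R) ^ ω)) :=
  lift _ (respects_seqGen hab rfl hγ)

/-- A functional `e` that is an eigenvector for a unit `u` is one for all its integral powers. -/
theorem apply_zpow_unit {V : Type*} [AddCommGroup V] [Module k V]
    (ρ : LiuAlgebra k n ω γ →ₐ[k] Module.End k V) (e : V →ₗ[k] R) (u : (LiuAlgebra k n ω γ)ˣ)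
    (b : Rˣ) (h : ∀ v, e (ρ u v) = b * e v) (j : ℤ) (v : V) :
    e (ρ ((u ^ j : (LiuAlgebra k n ω γ)ˣ) : LiuAlgebra k n ω γ) v) = (b ^ j : Rˣ) * e v := by
  induction j with
  | zero => simp
  | succ j ih =>
    rw [add_comm, zpow_one_add, zpow_one_add, Units.val_mul, Units.val_mul, map_mul,
      Module.End.mul_apply, h, ih, mul_assoc]
  | pred j ih =>
    rw [← Units.mul_right_inj b, ← h, ← Module.End.mul_apply, ← map_mul, ← Units.val_mul,
      ← zpow_one_add, add_sub_cancel, ih, ← mul_assoc, ← Units.val_mul, ← zpow_one_add,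
      add_sub_cancel]

variable [NeZero n]

theorem seqRep_mon_apply_zero {a b : Rˣ} (hab : a ^ ω = b ^ n) (hγ : γ ^ n = 1) (i j : ℤ) (l : ℕ)
    (f : quasiPeriodic k n (1 - (a : R) ^ ω)) :
    (seqRep (ω := ω) hab hγ (mon i j l) f).1 0 = (a ^ i * b ^ j : Rˣ) * f.1 l := by
  have hx := apply_zpow_unit (seqRep (ω := ω) hab hγ) (evalZero k n _) xUnit a (fun v => by
    simp [seqRep, xUnit, lift_gen, seqGen, evalZero, scale_apply])
  have hg := apply_zpow_unit (seqRep (ω := ω) hab hγ) (evalZero k n _) gUnit b (fun v => by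
    simp [seqRep, gUnit, lift_gen, seqGen, evalZero, scale_apply])
  have hy : (seqRep (ω := ω) hab hγ (gen .y ^ l) f).1 0 = f.1 l := by
    rw [map_pow, seqRep, lift_gen, seqGen, shift_pow_apply, zero_add]
  rw [mon, Units.val_mul, map_mul, map_mul, Module.End.mul_apply, Module.End.mul_apply]
  refine (hx i _).trans ?_
  rw [hg, Units.val_mul, mul_assoc]
  exact congrArg _ (congrArg _ hy)

variable [hγ : Fact (IsPrimitiveRoot γ n)]

variable (k n) in
/-- The sequence in `quasiPeriodic k n c` with value `1` at `r` and `0` at `l < n`, `l ≠ r`. It is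
zero if `n ≤ r`. -/
def seqVec (c : R) (r : ℕ) : quasiPeriodic k n c :=
  ⟨fun l => if l % n = r then c ^ (l / n) else 0, fun l => by
    beta_reduce
    rw [Nat.add_mod_right, Nat.add_div_right _ (NeZero.pos n), pow_succ']
    split_ifs <;> simp⟩

/-- The form with value `θ (a ^ i b ^ j)` on `x ^ i g ^ j y ^ r` and `0` on `x ^ i g ^ j y ^ l` for
`l < n`, `l ≠ r`. -/
def seqForm [FiniteDimensional k R] {a b : Rˣ} (hab : a ^ ω = b ^ n) (θ : R →ₗ[k] k) (r : ℕ) :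
    FiniteDual k (LiuAlgebra k n ω γ) :=
  FiniteDual.matrixCoeff (seqRep (ω := ω) hab hγ.out.pow_eq_one) (seqVec k n _ r)
    (θ ∘ₗ evalZero k n _)

theorem eval_seqForm [FiniteDimensional k R] {a b : Rˣ} (hab : a ^ ω = b ^ n) (θ : R →ₗ[k] k)
    (r : ℕ) (i j : ℤ) {l : ℕ} (hl : l < n) :
    FiniteDual.eval (mon i j l) (seqForm (γ := γ) hab θ r) =
      if l = r then θ (a ^ i * b ^ j : Rˣ) else 0 := by
  rw [seqForm, FiniteDual.eval_matrixCoeff]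
  refine (congrArg θ (seqRep_mon_apply_zero hab hγ.out.pow_eq_one i j l _)).trans ?_
  simp only [seqVec, Nat.mod_eq_of_lt hl, Nat.div_eq_of_lt hl, pow_zero]
  split_ifs <;> simp

end LiuAlgebra

/-! ### The forms attached to the generators and their relations -/

/-- The unit `1 + c ε` of the dual numbers, multiplicative in `c` since `ε ^ 2 = 0`. -/
def dualNumberExp (k : Type*) [Field k] : Multiplicative k →* (DualNumber k)ˣ :=
  MonoidHom.toHomUnits
    { toFun := fun c => 1 + TrivSqZeroExt.inr (Multiplicative.toAdd c)
      map_one' := by simp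
      map_mul' := fun c d => by
        ext
        · simp
        · simp [add_comm] }

theorem snd_dualNumberExp {k : Type*} [Field k] (c : Multiplicative k) :
    TrivSqZeroExt.sndHom k k (dualNumberExp k c : DualNumber k) = Multiplicative.toAdd c := by
  simp [dualNumberExp]

instance finiteDimensional_dualNumber (k : Type*) [Field k] : FiniteDimensional k (DualNumber k) :=
  inferInstanceAs (FiniteDimensional k (k × k))

namespace RootPair

variable {k : Type*} [Field k] {n ω : ℕ}

/-- The character `(i, j) ↦ α ^ i β ^ j`. -/
def char (p : RootPair k n ω) (i j : ℤ) : k := (p.1.1 ^ i * p.1.2 ^ j : kˣ)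

theorem char_mul (p q : RootPair k n ω) (i j : ℤ) :
    char (p * q) i j = char p i j * char q i j := by
  simp only [char, ← Units.val_mul, Subgroup.coe_mul, Prod.fst_mul, Prod.snd_mul, mul_zpow]
  rw [mul_mul_mul_comm]

theorem char_one (i j : ℤ) : char (1 : RootPair k n ω) i j = 1 := by simp [char]

theorem char_inv (p : RootPair k n ω) (i j : ℤ) : char (p⁻¹) i j = char p (-i) (-j) := by
  simp [char]

theorem char_add (p : RootPair k n ω) (i j i' j' : ℤ) :
    char p (i + i') (j + j') = char p i j * char p i' j' := by
  simp only [char, ← Units.val_mul, zpow_add]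
  rw [mul_mul_mul_comm]

theorem char_add_one (p : RootPair k n ω) (i j : ℤ) :
    char p i (j + 1) = p.1.2 * char p i j := by
  rw [← add_zero i, char_add, add_zero, mul_comm]; simp [char]

theorem char_add_ω (p : RootPair k n ω) (i j : ℤ) :
    char p (i + ω) j = (p.1.1 : k) ^ ω * char p i j := by
  rw [← add_zero j, char_add, add_zero, mul_comm]; simp [char]

theorem char_zero (p : RootPair k n ω) : char p 0 0 = 1 := by simp [char]

theorem char_ne_zero (p : RootPair k n ω) (i j : ℤ) : char p i j ≠ 0 := Units.ne_zero _

theorem char_one_root (n ω : ℕ) (γ : k) [NeZero n] [hγ : Fact (IsPrimitiveRoot γ n)] (i j : ℤ) :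
    char (one_root n ω γ) i j = γ ^ j := by
  simp [char, one_root]

theorem char_pow (p : RootPair k n ω) (m : ℕ) (i j : ℤ) :
    char (p ^ m) i j = char p i j ^ m := by
  induction m with
  | zero => simp [char_one]
  | succ m ih => rw [pow_succ, char_mul, ih, pow_succ]

end RootPair

/-- The additive character `(i, j) ↦ i / ω + j / n`. -/
def linChar (k : Type*) [Field k] (n ω : ℕ) (i j : ℤ) : k := (i : k) / ω + (j : k) / n

section linChar

variable {k : Type*} [Field k] {n ω : ℕ}

theorem linChar_add (i j i' j' : ℤ) :
    linChar k n ω (i + i') (j + j') = linChar k n ω i j + linChar k n ω i' j' := by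
  simp [linChar, add_div]; ring

theorem linChar_neg (i j : ℤ) : linChar k n ω (-i) (-j) = -linChar k n ω i j := by
  simp [linChar, neg_div]; ring

theorem linChar_zero : linChar k n ω 0 0 = 0 := by simp [linChar]

theorem linChar_add_one (i j : ℤ) : linChar k n ω i (j + 1) = linChar k n ω i j + 1 / n := by
  simp [linChar, add_div]; ring

theorem linChar_one_add (i j : ℤ) : linChar k n ω (i + 1) j = linChar k n ω i j + 1 / ω := by
  simp [linChar, add_div]; ring

theorem linChar_add_ω [CharZero k] [NeZero ω] (i j : ℤ) :
    linChar k n ω (i + ω) j = linChar k n ω i j + 1 := by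
  have : (ω : k) ≠ 0 := Nat.cast_ne_zero.2 (NeZero.ne ω)
  simp [linChar, add_div, this]; ring

end linChar

namespace LiuAlgebra

open FiniteDual

variable {k : Type*} [Field k] {n ω : ℕ} {γ : k} [hγ : Fact (IsPrimitiveRoot γ n)]

theorem qFactorial_ne_zero {m : ℕ} (hm : m < n) : LiuDual.qFactorial γ m ≠ 0 := by
  refine Finset.prod_ne_zero_iff.2 fun i hi h => ?_
  have hi := Finset.mem_Icc.1 hi
  refine hγ.out.pow_ne_one_of_pos_of_lt (l := i) (by omega) (by omega) ?_
  rw [← sub_eq_zero, ← geom_sum_mul, h, zero_mul]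

variable [NeZero n]

/-- The form with values `α ^ i β ^ j` on `x ^ i g ^ j` and `0` on `x ^ i g ^ j y ^ l` for
`0 < l < n`. -/
def psi (p : RootPair k n ω) : FiniteDual k (LiuAlgebra k n ω γ) :=
  seqForm (a := p.1.1) (b := p.1.2) p.2 LinearMap.id 0

/-- The form with value `1` on `x ^ i g ^ j y` and `0` on `x ^ i g ^ j y ^ l` for `l < n`, `l ≠ 1`.
It is zero if `n = 1`. -/
def formOne (k : Type*) [Field k] (n ω : ℕ) (γ : k) [NeZero n] [Fact (IsPrimitiveRoot γ n)] :
    FiniteDual k (LiuAlgebra k n ω γ) :=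
  seqForm (R := k) (a := 1) (b := 1) (by simp) LinearMap.id 1

theorem eval_psi (p : RootPair k n ω) (i j : ℤ) {l : ℕ} (hl : l < n) :
    eval (mon i j l) (psi (γ := γ) p) = if l = 0 then RootPair.char p i j else 0 :=
  eval_seqForm _ _ _ _ _ hl

theorem eval_formOne (i j : ℤ) {l : ℕ} (hl : l < n) :
    eval (mon i j l) (formOne k n ω γ) = if l = 1 then 1 else 0 := by
  rw [formOne, eval_seqForm _ _ _ _ _ hl]
  simp

theorem eval_psi_mul (p : RootPair k n ω) (f : FiniteDual k (LiuAlgebra k n ω γ)) (i j : ℤ) {l : ℕ}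
    (hl : l < n) : eval (mon i j l) (psi p * f) = RootPair.char p i j * eval (mon i j l) f := by
  rw [eval_mon_mul_of_degree_zero (fun m hm hml => by rw [eval_psi p i j (by omega), if_neg hm]),
    eval_psi p i j (NeZero.pos n), if_pos rfl]

theorem eval_formOne_mul_zero (f : FiniteDual k (LiuAlgebra k n ω γ)) (i j : ℤ) :
    eval (mon i j 0) (formOne k n ω γ * f) = 0 := by
  rw [eval_mon_mul_of_degree_zero (fun m hm hml => absurd (Nat.le_zero.1 hml) hm),
    eval_formOne i j (NeZero.pos n), if_neg (by simp), zero_mul]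

theorem eval_formOne_mul_succ (f : FiniteDual k (LiuAlgebra k n ω γ)) (i j : ℤ) {l : ℕ}
    (hl : l + 1 < n) : eval (mon i j (l + 1)) (formOne k n ω γ * f) =
      (∑ r ∈ Finset.range (l + 1), γ ^ r) * eval (mon i (j + 1) l) f := by
  rw [eval_mon_mul_of_degree_one (fun m hm hml => by
    rw [eval_formOne i j (by omega), if_neg hm]), eval_formOne i j (by omega), if_pos rfl, mul_one]

theorem eval_formOne_pow (i j : ℤ) {l : ℕ} (hl : l < n) (m : ℕ) :
    eval (mon i j l) (formOne k n ω γ ^ m) = if l = m then LiuDual.qFactorial γ m else 0 := by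
  induction m generalizing j l with
  | zero => rw [pow_zero, eval_mon_one]; simp [LiuDual.qFactorial]
  | succ m ih =>
    rw [pow_succ']
    cases l with
    | zero => simp [eval_formOne_mul_zero]
    | succ l =>
      rw [eval_formOne_mul_succ _ _ _ hl, ih _ (by omega)]
      by_cases h : l = m
      · subst h
        rw [if_pos rfl, if_pos rfl, LiuDual.qFactorial, LiuDual.qFactorial,
          Finset.prod_Icc_succ_top (by omega), mul_comm]
      · rw [if_neg h, if_neg (by omega), mul_zero]

theorem psi_mul_psi (p q : RootPair k n ω) : psi (γ := γ) p * psi q = psi (p * q) :=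
  ext_mon fun i j l hl => by
    rw [eval_psi_mul _ _ _ _ hl, eval_psi _ _ _ hl, eval_psi _ _ _ hl, RootPair.char_mul]
    split_ifs <;> simp

theorem psi_one : psi (γ := γ) (1 : RootPair k n ω) = 1 :=
  ext_mon fun i j l hl => by rw [eval_psi _ _ _ hl, eval_mon_one, RootPair.char_one]

theorem psi_pow (p : RootPair k n ω) (m : ℕ) : psi (γ := γ) p ^ m = psi (p ^ m) := by
  induction m with
  | zero => rw [pow_zero, pow_zero, psi_one]
  | succ m ih => rw [pow_succ, pow_succ, ih, psi_mul_psi]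

variable [CharZero k] [NeZero ω]

/-- The form with values `i / ω + j / n` on `x ^ i g ^ j` and `0` on `x ^ i g ^ j y ^ l` for
`0 < l < n`. -/
def formTwo (k : Type*) [Field k] [CharZero k] (n ω : ℕ) (γ : k) [NeZero n] [NeZero ω]
    [Fact (IsPrimitiveRoot γ n)] : FiniteDual k (LiuAlgebra k n ω γ) :=
  seqForm (a := dualNumberExp k (.ofAdd (1 / (ω : k))))
    (b := dualNumberExp k (.ofAdd (1 / (n : k))))
    (by
      rw [← map_pow (dualNumberExp k), ← map_pow (dualNumberExp k), ← ofAdd_nsmul, ← ofAdd_nsmul]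
      congr 2
      simp [NeZero.ne n, NeZero.ne ω])
    (TrivSqZeroExt.sndHom k k) 0

theorem eval_formTwo (i j : ℤ) {l : ℕ} (hl : l < n) :
    eval (mon i j l) (formTwo k n ω γ) = if l = 0 then linChar k n ω i j else 0 := by
  rw [formTwo, eval_seqForm _ _ _ _ _ hl, ← map_zpow (dualNumberExp k),
    ← map_zpow (dualNumberExp k), ← map_mul (dualNumberExp k), snd_dualNumberExp]
  simp [linChar, div_eq_mul_inv]

theorem eval_formTwo_mul (f : FiniteDual k (LiuAlgebra k n ω γ)) (i j : ℤ) {l : ℕ} (hl : l < n) :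
    eval (mon i j l) (formTwo k n ω γ * f) = linChar k n ω i j * eval (mon i j l) f := by
  rw [eval_mon_mul_of_degree_zero (fun m hm hml => by rw [eval_formTwo i j (by omega), if_neg hm]),
    eval_formTwo i j (NeZero.pos n), if_pos rfl]

theorem eval_aeval_formTwo_mul (P : Polynomial k) (f : FiniteDual k (LiuAlgebra k n ω γ)) (i j : ℤ)
    {l : ℕ} (hl : l < n) : eval (mon i j l) (Polynomial.aeval (formTwo k n ω γ) P * f) =
      P.eval (linChar k n ω i j) * eval (mon i j l) f := by
  induction P using Polynomial.induction_on' with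
  | add P Q hP hQ => rw [map_add, add_mul, map_add, hP, hQ, Polynomial.eval_add, add_mul]
  | monomial m c =>
    rw [Polynomial.aeval_monomial, Polynomial.eval_monomial, mul_assoc, ← Algebra.smul_def,
      map_smul, smul_eq_mul, mul_assoc]
    congr 1
    induction m with
    | zero => simp
    | succ m ih => rw [pow_succ', mul_assoc, eval_formTwo_mul _ _ _ hl, ih, pow_succ', mul_assoc]

end LiuAlgebra

namespace LiuDual

open LiuAlgebra FiniteDual

variable {k : Type*} [Field k] {n ω : ℕ} {γ : k} [NeZero n] [hγ : Fact (IsPrimitiveRoot γ n)]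
  [CharZero k] [NeZero ω]

variable (k n ω γ) in
/-- The forms on `B(n, ω, γ)` assigned to the generators of `B_∘(n, ω, γ)`. -/
def genForm : Gen k n ω → FiniteDual k (LiuAlgebra k n ω γ)
  | .Ψ p => psi p
  | .F₁ => formOne k n ω γ
  | .F₂ => formTwo k n ω γ

theorem lift_genForm_rel ⦃a b : FreeAlgebra k (Gen k n ω)⦄ (h : Rel k n ω a b) :
    FreeAlgebra.lift k (genForm k n ω γ) a = FreeAlgebra.lift k (genForm k n ω γ) b := by
  cases h <;> simp only [map_mul, map_one, map_pow, map_zero, map_add, map_smul,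
    FreeAlgebra.lift_ι_apply, genForm]
  case Ψ_mul_Ψ p q => exact psi_mul_psi p q
  case Ψ_one => exact psi_one
  all_goals refine ext_mon fun i j l hl => ?_
  case F₁_pow => rw [eval_formOne_pow _ _ hl, if_neg hl.ne, map_zero]
  case F₂_mul_Ψ p =>
    rw [eval_formTwo_mul _ _ _ hl, eval_psi_mul _ _ _ _ hl, eval_psi _ _ _ hl, eval_formTwo _ _ hl]
    split_ifs <;> simp [mul_comm]
  case F₁_mul_Ψ p =>
    rw [map_smul, eval_psi_mul _ _ _ _ hl]
    cases l with
    | zero => rw [eval_formOne_mul_zero, eval_formOne _ _ hl]; simp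
    | succ l =>
      rw [eval_formOne_mul_succ _ _ _ hl, eval_psi _ _ _ (by omega), eval_formOne _ _ hl,
        RootPair.char_add_one]
      by_cases h : l = 0 <;> simp [h]
  case F₁_mul_F₂ =>
    rw [map_add, map_smul, eval_formTwo_mul _ _ _ hl]
    cases l with
    | zero => rw [eval_formOne_mul_zero, eval_formOne _ _ hl]; simp
    | succ l =>
      rw [eval_formOne_mul_succ _ _ _ hl, eval_formTwo _ _ (by omega), eval_formOne _ _ hl,
        linChar_add_one]
      by_cases h : l = 0 <;> simp [h]

variable (k n ω γ) in
/-- The algebra homomorphism `B_∘(n, ω, γ) → B(n, ω, γ)°`. -/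
def toFiniteDual : LiuDual k n ω →ₐ[k] FiniteDual k (LiuAlgebra k n ω γ) :=
  RingQuot.liftAlgHom k ⟨FreeAlgebra.lift k (genForm k n ω γ), lift_genForm_rel⟩

theorem toFiniteDual_gen (i : Gen k n ω) :
    toFiniteDual k n ω γ (RingQuot.mkAlgHom k (Rel k n ω) (FreeAlgebra.ι k i)) =
      genForm k n ω γ i :=
  (RingQuot.liftAlgHom_mkAlgHom_apply k _ lift_genForm_rel _).trans (FreeAlgebra.lift_ι_apply _ _)

theorem toFiniteDual_Ψ (p : RootPair k n ω) : toFiniteDual k n ω γ (Ψ p) = psi p :=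
  toFiniteDual_gen (.Ψ p)

theorem toFiniteDual_F₁ : toFiniteDual k n ω γ F₁ = formOne k n ω γ := toFiniteDual_gen .F₁

theorem toFiniteDual_F₂ : toFiniteDual k n ω γ F₂ = formTwo k n ω γ := toFiniteDual_gen .F₂

end LiuDual

/-! ### Comultiplication and antipode of the forms -/

namespace LiuAlgebra

open FiniteDual RootPair Coalgebra

variable {k : Type*} [Field k] {n ω : ℕ} {γ : k} [NeZero n] [hγ : Fact (IsPrimitiveRoot γ n)]

theorem antipode_psi (p : RootPair k n ω) :
    HopfAlgebra.antipode k (psi (γ := γ) p) = psi p⁻¹ :=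
  ext_mon fun i j l hl => by
    refine (eval_antipodeₗ _ _).trans ?_
    rw [eval_psi _ _ _ hl]
    split_ifs with h
    · rw [h, antipode_mon_zero, eval_psi _ _ _ (NeZero.pos n), if_pos rfl, char_inv]
    · obtain ⟨c, i', j', hc⟩ := exists_antipode_mon (n := n) (ω := ω) (γ := γ) i j l
      rw [hc, eval_smul, eval_psi _ _ _ hl, if_neg h, smul_zero]

theorem antipode_formOne : HopfAlgebra.antipode k (formOne k n ω γ) =
    -(γ ^ (n - 1) • (psi (one_root n ω γ) ^ (n - 1) * formOne k n ω γ)) :=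
  ext_mon fun i j l hl => by
    refine (eval_antipodeₗ _ _).trans ?_
    rw [map_neg, map_smul, psi_pow, eval_psi_mul _ _ _ _ hl, char_pow, char_one_root,
      eval_formOne _ _ hl, smul_eq_mul]
    split_ifs with h
    · subst h
      have h0 := root_ne_zero n γ
      have hz : (γ ^ (j + 1)) ^ n = 1 := by
        rw [← zpow_natCast, ← zpow_mul, mul_comm, zpow_mul, zpow_natCast, hγ.out.pow_eq_one,
          one_zpow]
      have hi : (γ ^ (j + 1))⁻¹ = γ ^ (n - 1) * (γ ^ j) ^ (n - 1) := by
        rw [← mul_pow, mul_comm γ, ← zpow_add_one₀ h0]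
        refine inv_eq_of_mul_eq_one_right ?_
        rw [← pow_succ', Nat.sub_add_cancel NeZero.one_le, hz]
      rw [antipode_mon_one, ← neg_smul, eval_smul, eval_formOne _ _ hl, if_pos rfl, hi]
      simp
    · obtain ⟨c, i', j', hc⟩ := exists_antipode_mon (n := n) (ω := ω) (γ := γ) i j l
      rw [hc, eval_smul, eval_formOne _ _ hl, if_neg h]
      simp

theorem comul_formOne : comul (R := k) (formOne k n ω γ) =
    1 ⊗ₜ[k] formOne k n ω γ + formOne k n ω γ ⊗ₜ[k] psi (one_root n ω γ) :=
  ext_mon₂ fun i j l hl i' j' l' hl' => by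
    rw [eval₂_comul_mon, map_add, eval₂_tmul, eval₂_tmul, eval_mon_one, eval_formOne _ _ hl,
      eval_formOne _ _ hl', eval_psi _ _ _ hl', char_one_root]
    rcases lt_or_ge (l + l') n with h | h
    · rw [eval_formOne _ _ h]
      rcases Nat.eq_zero_or_pos l with rfl | h0
      · simp
      · rcases Nat.eq_zero_or_pos l' with rfl | h0'
        · by_cases h1 : l = 1 <;> simp [h1, h0.ne']
        · simp [h0.ne', h0'.ne', show l + l' ≠ 1 by omega]
    · obtain ⟨r, hr⟩ := Nat.exists_eq_add_of_le' h
      rw [hr, eval_mon_add_n, eval_formOne _ _ (by omega), eval_formOne _ _ (by omega), sub_self,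
        mul_zero, if_neg (show l ≠ 0 by omega), if_neg (show l' ≠ 0 by omega)]
      simp

/-- The pairing of `Δ(f)` with monomials, for a form `f` supported in `y`-degree `0`. In
`y`-degree `n` it is governed by `y ^ n = 1 - x ^ ω`. -/
theorem eval₂_comul_of_degree_zero {f : FiniteDual k (LiuAlgebra k n ω γ)} {φ : ℤ → ℤ → k}
    (hf : ∀ i j, ∀ l < n, eval (mon i j l) f = if l = 0 then φ i j else 0)
    (i j : ℤ) {l : ℕ} (hl : l < n) (i' j' : ℤ) {l' : ℕ} (hl' : l' < n) :
    eval₂ (mon i j l) (mon i' j' l') (comul (R := k) f) =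
      if l = 0 ∧ l' = 0 then φ (i + i') (j + j') else
      if l + l' = n then (γ ^ j') ^ l * (φ (i + i') (j + j') - φ (i + i' + ω) (j + j')) else 0 := by
  rw [eval₂_comul_mon]
  rcases lt_or_ge (l + l') n with h | h
  · rw [hf _ _ _ h, if_neg h.ne]
    by_cases h0 : l = 0 ∧ l' = 0
    · simp [h0]
    · rw [if_neg h0, if_neg (by omega), mul_zero]
  · obtain ⟨r, hr⟩ := Nat.exists_eq_add_of_le' h
    rw [if_neg (by omega), hr, eval_mon_add_n, hf _ _ _ (by omega), hf _ _ _ (by omega)]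
    by_cases h0 : r = 0
    · simp [h0]
    · simp [h0]

variable [CharZero k] [NeZero ω]

theorem antipode_formTwo : HopfAlgebra.antipode k (formTwo k n ω γ) = -formTwo k n ω γ :=
  ext_mon fun i j l hl => by
    refine (eval_antipodeₗ _ _).trans ?_
    rw [map_neg, eval_formTwo _ _ hl]
    split_ifs with h
    · rw [h, antipode_mon_zero, eval_formTwo _ _ (NeZero.pos n), if_pos rfl, linChar_neg]
    · obtain ⟨c, i', j', hc⟩ := exists_antipode_mon (n := n) (ω := ω) (γ := γ) i j l
      rw [hc, eval_smul, eval_formTwo _ _ hl, if_neg h, smul_zero, neg_zero]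

end LiuAlgebra

namespace LiuDual

open LiuAlgebra FiniteDual RootPair Coalgebra

variable {k : Type*} [Field k] {n ω : ℕ} {γ : k} [NeZero n] [hγ : Fact (IsPrimitiveRoot γ n)]
  [CharZero k] [NeZero ω]

theorem eval_toFiniteDual_dividedF₁ (i j : ℤ) {l m : ℕ} (hl : l < n) (hm : m < n) :
    eval (mon i j l) (toFiniteDual k n ω γ (dividedF₁ γ m)) = if l = m then 1 else 0 := by
  rw [dividedF₁, map_smul, map_smul, map_pow, toFiniteDual_F₁, eval_formOne_pow _ _ hl]
  split_ifs
  · exact inv_mul_cancel₀ (qFactorial_ne_zero hm)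
  · exact smul_zero _

theorem eval₂_crossTerm (i j : ℤ) {l : ℕ} (hl : l < n) (i' j' : ℤ) {l' : ℕ} (hl' : l' < n) :
    eval₂ (mon i j l) (mon i' j' l') (Algebra.TensorProduct.map (toFiniteDual k n ω γ)
      (toFiniteDual k n ω γ) (crossTerm γ)) = if l + l' = n then (γ ^ j') ^ l else 0 := by
  have h : ∀ m ∈ Finset.Ico 1 n, eval₂ (mon i j l) (mon i' j' l')
      (Algebra.TensorProduct.map (toFiniteDual k n ω γ) (toFiniteDual k n ω γ)
        (dividedF₁ γ m ⊗ₜ[k] (Ψ (one_root n ω γ) ^ m * dividedF₁ γ (n - m)))) =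
      if m = l then if l + l' = n then (γ ^ j') ^ l else 0 else 0 := by
    intro m hm
    have hm := Finset.mem_Ico.1 hm
    rw [Algebra.TensorProduct.map_tmul, eval₂_tmul, map_mul, map_pow, toFiniteDual_Ψ, psi_pow,
      eval_psi_mul _ _ _ _ hl', eval_toFiniteDual_dividedF₁ _ _ hl hm.2,
      eval_toFiniteDual_dividedF₁ _ _ hl' (by omega), char_pow, char_one_root]
    by_cases h1 : m = l
    · subst h1
      rw [if_pos rfl, if_pos rfl, one_mul]
      by_cases h2 : m + l' = n
      · rw [if_pos h2, if_pos (by omega), mul_one]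
      · rw [if_neg h2, if_neg (by omega), mul_zero]
    · rw [if_neg h1, if_neg (Ne.symm h1), zero_mul]
  rw [crossTerm, map_sum, map_sum, Finset.sum_congr rfl h, Finset.sum_ite_eq']
  by_cases h2 : l + l' = n
  · rw [if_pos (Finset.mem_Ico.2 (by omega))]
  · rw [if_neg h2, ite_self]

theorem comul_formTwo : comul (R := k) (formTwo k n ω γ) =
    1 ⊗ₜ[k] formTwo k n ω γ + formTwo k n ω γ ⊗ₜ[k] 1 -
      Algebra.TensorProduct.map (toFiniteDual k n ω γ) (toFiniteDual k n ω γ) (crossTerm γ) :=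
  ext_mon₂ fun i j l hl i' j' l' hl' => by
    rw [eval₂_comul_of_degree_zero (fun i j l hl => eval_formTwo i j hl) _ _ hl _ _ hl', map_sub,
      map_add, eval₂_tmul, eval₂_tmul, eval₂_crossTerm _ _ hl _ _ hl', eval_mon_one, eval_mon_one,
      eval_formTwo _ _ hl, eval_formTwo _ _ hl', linChar_add_ω, linChar_add]
    have := NeZero.ne n
    rcases Nat.eq_zero_or_pos l with rfl | h0
    · rcases Nat.eq_zero_or_pos l' with rfl | h0'
      · simp [this.symm, add_comm]
      · simp [h0'.ne', hl'.ne]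
    · by_cases h2 : l + l' = n <;> simp [h0.ne', h2]

theorem comul_psi (p : RootPair k n ω) : comul (R := k) (psi (γ := γ) p) =
    (psi p ⊗ₜ[k] psi p) * (1 ⊗ₜ[k] 1 + (1 - (p.1.1 : k) ^ ω) •
      Algebra.TensorProduct.map (toFiniteDual k n ω γ) (toFiniteDual k n ω γ) (crossTerm γ)) := by
  have hmul : ∀ (i j : ℤ) (l : ℕ), l < n → ∀ (i' j' : ℤ) (l' : ℕ), l' < n →
      ∀ t, eval₂ (mon i j l) (mon i' j' l') (psi (γ := γ) p ⊗ₜ[k] psi p * t) =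
        char p i j * char p i' j' * eval₂ (mon i j l) (mon i' j' l') t := by
    intro i j l hl i' j' l' hl' t
    induction t with
    | zero => simp
    | add s t hs ht => rw [mul_add, map_add, map_add, hs, ht, mul_add]
    | tmul s t =>
      rw [Algebra.TensorProduct.tmul_mul_tmul, eval₂_tmul, eval₂_tmul, eval_psi_mul _ _ _ _ hl,
        eval_psi_mul _ _ _ _ hl', mul_mul_mul_comm]
  refine ext_mon₂ fun i j l hl i' j' l' hl' => ?_
  rw [eval₂_comul_of_degree_zero (fun i j l hl => eval_psi p i j hl) _ _ hl _ _ hl',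
    hmul _ _ _ hl _ _ _ hl', map_add, map_smul, eval₂_tmul, eval₂_crossTerm _ _ hl _ _ hl',
    eval_mon_one, eval_mon_one, char_add_ω, char_add]
  have := NeZero.ne n
  rcases Nat.eq_zero_or_pos l with rfl | h0
  · rcases Nat.eq_zero_or_pos l' with rfl | h0'
    · simp [this.symm]
    · simp [h0'.ne', hl'.ne]
  · by_cases h2 : l + l' = n
    · simp [h0.ne', h2]
      ring
    · simp [h0.ne', h2]

end LiuDual

end

noncomputable section

open Polynomial

/-! ### Exponential polynomials on `ℤ × ℤ`: linear independence -/

section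

variable {k : Type*} [Field k]

/-- In a finite sum of vectors from independent subspaces that vanishes, all terms vanish. -/
theorem iSupIndep.eq_zero_of_sum_eq_zero {ι V : Type*} [AddCommGroup V] [Module k V]
    {A : ι → Submodule k V} (hA : iSupIndep A) {s : Finset ι} {v : ι → V}
    (hv : ∀ i ∈ s, v i ∈ A i) (h0 : ∑ i ∈ s, v i = 0) {i : ι} (hi : i ∈ s) : v i = 0 := by
  classical
  rw [← Finset.add_sum_erase s v hi] at h0
  refine Submodule.disjoint_def.1 (hA i) _ (hv i hi) ?_
  rw [eq_neg_of_add_eq_zero_left h0]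
  refine neg_mem (sum_mem fun j hj => ?_)
  have hj := Finset.mem_erase.1 hj
  exact Submodule.mem_iSup_of_mem j (Submodule.mem_iSup_of_mem hj.1 (hv j hj.2))

theorem mem_maxGenEigenspace_of_sub_smul {V : Type*} [AddCommGroup V] [Module k V]
    {f : Module.End k V} {μ : k} {v : V} (h : f v - μ • v ∈ f.maxGenEigenspace μ) :
    v ∈ f.maxGenEigenspace μ := by
  rw [Module.End.mem_maxGenEigenspace] at h ⊢
  obtain ⟨N, hN⟩ := h
  refine ⟨N + 1, ?_⟩
  rw [pow_succ, Module.End.mul_apply]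
  exact hN

/-- The discrete antiderivative of a polynomial, through the Bernoulli polynomials. -/
theorem exists_eval_add_sub_eval [CharZero k] {s : k} (hs : s ≠ 0) (P : k[X]) :
    ∃ R : k[X], ∀ t, R.eval (t + s) - R.eval t = P.eval t := by
  induction P using Polynomial.induction_on' with
  | add P Q hP hQ =>
    obtain ⟨R, hR⟩ := hP
    obtain ⟨R', hR'⟩ := hQ
    refine ⟨R + R', fun t => ?_⟩
    rw [eval_add, eval_add, eval_add, ← hR, ← hR']
    ring
  | monomial m a =>
    have hB : ∀ x : k, ((Polynomial.bernoulli (m + 1)).map (algebraMap ℚ k)).eval (x + 1) =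
        ((Polynomial.bernoulli (m + 1)).map (algebraMap ℚ k)).eval x + (m + 1) * x ^ m := by
      intro x
      have h := congrArg (fun p => (p.map (algebraMap ℚ k)).eval x)
        (bernoulli_comp_one_add_X (m + 1))
      simpa [Polynomial.map_comp, add_comm] using h
    refine ⟨C (a * s ^ m / (m + 1)) *
      ((Polynomial.bernoulli (m + 1)).map (algebraMap ℚ k)).comp (C s⁻¹ * X), fun t => ?_⟩
    have hm : (m + 1 : k) ≠ 0 := Nat.cast_add_one_ne_zero m
    simp only [eval_mul, eval_C, eval_comp, eval_X, eval_monomial]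
    rw [mul_add, inv_mul_cancel₀ hs, hB, mul_pow, inv_pow]
    field_simp
    ring

end

namespace LiuDual

open RootPair

variable {k : Type*} [Field k] {n ω : ℕ}

/-- The function `(i, j) ↦ α ^ i β ^ j P(i / ω + j / n)`. -/
def expPoly (p : RootPair k n ω) : k[X] →ₗ[k] (ℤ → ℤ → k) where
  toFun P i j := char p i j * P.eval (linChar k n ω i j)
  map_add' P Q := by ext i j; simp [mul_add]
  map_smul' c P := by ext i j; simp [mul_left_comm]

theorem expPoly_apply (p : RootPair k n ω) (P : k[X]) (i j : ℤ) :
    expPoly p P i j = char p i j * P.eval (linChar k n ω i j) := rfl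

variable (k) in
/-- The two shifts on functions on `ℤ × ℤ`. -/
def shiftFun : Bool → Module.End k (ℤ → ℤ → k)
  | false => { toFun := fun f i j => f (i + 1) j, map_add' := fun _ _ => rfl,
               map_smul' := fun _ _ => rfl }
  | true => { toFun := fun f i j => f i (j + 1), map_add' := fun _ _ => rfl,
              map_smul' := fun _ _ => rfl }

theorem commute_shiftFun (b b' : Bool) : Commute (shiftFun k b) (shiftFun k b') := by
  cases b <;> cases b' <;> rfl

/-- The coordinates of a pair `(α, β)`, as eigenvalues of the two shifts. -/
def eigenvalue (p : RootPair k n ω) : Bool → k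
  | false => p.1.1
  | true => p.1.2

theorem eigenvalue_injective :
    Function.Injective (eigenvalue : RootPair k n ω → Bool → k) := fun _ _ h =>
  Subtype.ext (Prod.ext (Units.ext (congrFun h false)) (Units.ext (congrFun h true)))

/-- The discrete derivative `P(t + s) - P(t)` has smaller degree, so `expPoly p P` is killed by a
power of the shift minus its eigenvalue. -/
theorem expPoly_mem_maxGenEigenspace (p : RootPair k n ω) (P : k[X]) (b : Bool) :
    expPoly p P ∈ (shiftFun k b).maxGenEigenspace (eigenvalue p b) := by
  have key : ∃ s : k, ∀ P, shiftFun k b (expPoly p P) - eigenvalue p b • expPoly p P =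
      eigenvalue p b • expPoly p (taylor s P - P) := by
    cases b
    · refine ⟨1 / ω, fun P => ?_⟩
      ext i j
      have h : char p (i + 1) j = p.1.1 * char p i j := by
        rw [← add_zero j, char_add, add_zero, mul_comm]; simp [char]
      simp only [shiftFun, eigenvalue, LinearMap.coe_mk, AddHom.coe_mk, Pi.sub_apply,
        Pi.smul_apply, expPoly_apply, linChar_one_add, h, eval_sub, taylor_eval, smul_eq_mul]
      ring
    · refine ⟨1 / n, fun P => ?_⟩
      ext i j
      simp only [shiftFun, eigenvalue, LinearMap.coe_mk, AddHom.coe_mk, Pi.sub_apply,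
        Pi.smul_apply, expPoly_apply, linChar_add_one, char_add_one, eval_sub, taylor_eval,
        smul_eq_mul]
      ring
  obtain ⟨s, hs⟩ := key
  induction h : P.natDegree using Nat.strong_induction_on generalizing P with
  | _ d ih =>
    refine mem_maxGenEigenspace_of_sub_smul ?_
    rw [hs]
    refine Submodule.smul_mem _ _ ?_
    by_cases h0 : taylor s P - P = 0
    · rw [h0, map_zero]; exact zero_mem _
    · have hP : taylor s P ≠ 0 := fun h => h0 (by rw [h, (taylor_eq_zero s P).1 h, sub_zero])
      have hd := natDegree_lt_natDegree h0
        (degree_sub_lt_left (degree_taylor P s) hP (leadingCoeff_taylor s P))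
      rw [natDegree_taylor] at hd
      exact ih _ (h ▸ hd) _ rfl

variable [CharZero k]

theorem eq_of_eval_linChar_eq [NeZero ω] {P Q : k[X]}
    (h : ∀ i : ℤ, P.eval (linChar k n ω i 0) = Q.eval (linChar k n ω i 0)) : P = Q := by
  refine eq_of_infinite_eval_eq P Q (Set.infinite_of_injective_forall_mem
    (f := fun i : ℤ => linChar k n ω i 0) (fun i i' hi => ?_) h)
  have : (ω : k) ≠ 0 := Nat.cast_ne_zero.2 (NeZero.ne ω)
  simpa [linChar, div_left_inj' this] using hi

/-- The functions `χ P(λ)`, for distinct characters `χ`, are linearly independent. -/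
theorem eq_zero_of_sum_expPoly_eq_zero [NeZero ω] {c : RootPair k n ω →₀ k[X]}
    (hc : c.sum (fun p P => expPoly p P) = 0) : c = 0 := by
  have hind : iSupIndep fun p : RootPair k n ω =>
      ⨅ b, (shiftFun k b).maxGenEigenspace (eigenvalue p b) :=
    (Module.End.independent_iInf_maxGenEigenspace_of_forall_mapsTo (shiftFun k) fun b b' μ =>
      Module.End.mapsTo_maxGenEigenspace_of_comm (commute_shiftFun b' b) μ).comp
        eigenvalue_injective
  ext1 p
  by_cases hp : p ∈ c.support
  · have h := hind.eq_zero_of_sum_eq_zero (fun q _ => (Submodule.mem_iInf _).2 fun b =>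
      expPoly_mem_maxGenEigenspace q (c q) b) hc hp
    refine eq_of_eval_linChar_eq (n := n) (ω := ω) fun i => ?_
    have h' := congrFun (congrFun h i) 0
    rw [expPoly_apply] at h'
    simpa using (mul_eq_zero.1 h').resolve_left (char_ne_zero p i 0)
  · exact Finsupp.notMem_support_iff.1 hp

end LiuDual

/-! ### Normal forms and injectivity -/

namespace LiuDual

open LiuAlgebra FiniteDual RootPair

section

variable {k : Type*} [Field k] {n ω : ℕ}

theorem induction {P : LiuDual k n ω → Prop} (hΨ : ∀ p, P (Ψ p)) (hF₁ : P F₁) (hF₂ : P F₂)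
    (hmap : ∀ r, P (algebraMap k _ r)) (hadd : ∀ a b, P a → P b → P (a + b))
    (hmul : ∀ a b, P a → P b → P (a * b)) (a : LiuDual k n ω) : P a := by
  obtain ⟨a, rfl⟩ := RingQuot.mkAlgHom_surjective k (Rel k n ω) a
  induction a using FreeAlgebra.induction with
  | grade0 r => rw [AlgHom.commutes]; exact hmap r
  | grade1 i =>
    cases i with
    | Ψ p => exact hΨ p
    | F₁ => exact hF₁
    | F₂ => exact hF₂
  | mul a b ha hb => rw [map_mul]; exact hmul _ _ ha hb
  | add a b ha hb => rw [map_add]; exact hadd _ _ ha hb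

theorem of_rel {a b : FreeAlgebra k (Gen k n ω)} (h : Rel k n ω a b) :
    RingQuot.mkAlgHom k (Rel k n ω) a = RingQuot.mkAlgHom k (Rel k n ω) b :=
  RingQuot.mkAlgHom_rel k h

theorem Ψ_mul_Ψ (p q : RootPair k n ω) : Ψ p * Ψ q = Ψ (p * q) := by
  simpa using! of_rel (Rel.Ψ_mul_Ψ p q)

theorem Ψ_one : Ψ (1 : RootPair k n ω) = 1 := by simpa using! of_rel Rel.Ψ_one

theorem F₁_pow : (F₁ : LiuDual k n ω) ^ n = 0 :=
  (map_pow (RingQuot.mkAlgHom k (Rel k n ω)) _ n).symm.trans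
    ((of_rel Rel.F₁_pow).trans (map_zero _))

theorem F₂_mul_Ψ (p : RootPair k n ω) : F₂ * Ψ p = Ψ p * F₂ := by
  simpa using! of_rel (Rel.F₂_mul_Ψ p)

theorem F₁_mul_Ψ (p : RootPair k n ω) : F₁ * Ψ p = (p.1.2 : k) • (Ψ p * F₁) := by
  simpa using! of_rel (Rel.F₁_mul_Ψ p)

theorem F₁_mul_F₂ : (F₁ : LiuDual k n ω) * F₂ = F₂ * F₁ + (1 / (n : k)) • F₁ := by
  simpa using! of_rel (Rel.F₁_mul_F₂ : Rel k n ω _ _)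

theorem F₁_mul_aeval_F₂ (P : k[X]) : (F₁ : LiuDual k n ω) * aeval (F₂ : LiuDual k n ω) P =
    aeval (F₂ : LiuDual k n ω) (taylor (1 / (n : k)) P) * F₁ := by
  induction P using Polynomial.induction_on' with
  | add P Q hP hQ => rw [map_add, mul_add, hP, hQ, map_add, map_add, add_mul]
  | monomial m c =>
    rw [taylor_monomial, aeval_monomial, ← Algebra.smul_def, mul_smul_comm, map_mul, aeval_C,
      ← Algebra.smul_def, smul_mul_assoc]
    congr 1
    induction m with
    | zero => simp
    | succ m ih =>
      rw [pow_succ', ← mul_assoc, F₁_mul_F₂, add_mul, mul_assoc, ih, smul_mul_assoc, ih, pow_succ',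
        map_mul, map_add, aeval_X, aeval_C, ← mul_assoc, ← smul_mul_assoc, ← add_mul, add_mul F₂,
        ← Algebra.smul_def]

variable (n) in
/-- The linear map `(P_p)_p ↦ ∑_p Ψ_p P_p(F₂) F₁ ^ l`. -/
def normalForm (l : ℕ) : (RootPair k n ω →₀ k[X]) →ₗ[k] LiuDual k n ω :=
  Finsupp.lsum k fun p =>
    LinearMap.mulRight k (F₁ ^ l) ∘ₗ LinearMap.mulLeft k (Ψ p) ∘ₗ (aeval F₂).toLinearMap

theorem normalForm_single (l : ℕ) (p : RootPair k n ω) (P : k[X]) :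
    normalForm n l (Finsupp.single p P) = Ψ p * aeval F₂ P * F₁ ^ l := by
  simp [normalForm]

/-- The elements `Ψ_p P(F₂) F₁ ^ l` with `l < n` span `B_∘(n, ω, γ)`. -/
theorem exists_eq_sum_normalForm [NeZero n] (a : LiuDual k n ω) :
    ∃ c : ℕ → RootPair k n ω →₀ k[X], a = ∑ l ∈ Finset.range n, normalForm n l (c l) := by
  let N : (ℕ → RootPair k n ω →₀ k[X]) →ₗ[k] LiuDual k n ω :=
    ∑ l ∈ Finset.range n, normalForm n l ∘ₗ LinearMap.proj l
  have hN : ∀ c, N c = ∑ l ∈ Finset.range n, normalForm n l (c l) := fun c => by simp [N]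
  set S := LinearMap.range N
  have hmem : ∀ (l : ℕ) (p : RootPair k n ω) (P : k[X]), Ψ p * aeval F₂ P * F₁ ^ l ∈ S := by
    intro l p P
    rcases lt_or_ge l n with h | h
    · refine ⟨Pi.single l (Finsupp.single p P), ?_⟩
      rw [hN, Finset.sum_eq_single_of_mem l (Finset.mem_range.2 h), Pi.single_eq_same,
        normalForm_single]
      intro m _ hm
      rw [Pi.single_eq_of_ne hm, map_zero]
    · rw [← Nat.sub_add_cancel h, pow_add, F₁_pow, mul_zero, mul_zero]
      exact S.zero_mem
  have hleft : ∀ u : LiuDual k n ω, (∀ (l : ℕ) (p : RootPair k n ω) (P : k[X]),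
      u * (Ψ p * aeval F₂ P * F₁ ^ l) ∈ S) → ∀ b ∈ S, u * b ∈ S := by
    rintro u hu _ ⟨c, rfl⟩
    rw [hN, Finset.mul_sum]
    refine S.sum_mem fun l _ => ?_
    induction c l using Finsupp.induction_linear with
    | zero => simp
    | add c d hc hd => rw [map_add, mul_add]; exact S.add_mem hc hd
    | single p P => rw [normalForm_single]; exact hu l p P
  have key : ∀ u : LiuDual k n ω, ∀ b ∈ S, u * b ∈ S := by
    intro u
    induction u using induction with
    | hΨ q =>
      refine hleft _ fun l p P => ?_
      rw [← mul_assoc, ← mul_assoc, Ψ_mul_Ψ]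
      exact hmem _ _ _
    | hF₁ =>
      refine hleft _ fun l p P => ?_
      rw [← mul_assoc, ← mul_assoc, F₁_mul_Ψ, smul_mul_assoc, smul_mul_assoc, mul_assoc (Ψ p),
        F₁_mul_aeval_F₂, ← mul_assoc, mul_assoc _ F₁, ← pow_succ']
      exact S.smul_mem _ (hmem _ _ _)
    | hF₂ =>
      refine hleft _ fun l p P => ?_
      have h : (F₂ : LiuDual k n ω) * aeval F₂ P = aeval F₂ (X * P) := by rw [map_mul, aeval_X]
      rw [← mul_assoc, ← mul_assoc, F₂_mul_Ψ, mul_assoc (Ψ p), h]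
      exact hmem _ _ _
    | hmap r => intro b hb; rw [← Algebra.smul_def]; exact S.smul_mem _ hb
    | hadd a b ha hb => intro c hc; rw [add_mul]; exact S.add_mem (ha c hc) (hb c hc)
    | hmul a b ha hb => intro c hc; rw [mul_assoc]; exact ha _ (hb c hc)
  have h1 : (1 : LiuDual k n ω) ∈ S := by simpa [Ψ_one] using hmem 0 1 1
  obtain ⟨c, hc⟩ := key a 1 h1
  exact ⟨c, by rw [← hN, hc, mul_one]⟩

end

variable {k : Type*} [Field k] [CharZero k] {n ω : ℕ} {γ : k} [NeZero n] [NeZero ω]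
  [hγ : Fact (IsPrimitiveRoot γ n)]

theorem eval_toFiniteDual_normalForm (m : ℕ) (c : RootPair k n ω →₀ k[X]) (i j : ℤ) {l : ℕ}
    (hl : l < n) : eval (mon i j l) (toFiniteDual k n ω γ (normalForm n m c)) =
      if l = m then c.sum (fun p P => expPoly p P) i j * qFactorial γ m else 0 := by
  induction c using Finsupp.induction_linear with
  | zero => simp
  | add c d hc hd =>
    rw [map_add, map_add, map_add, hc, hd, Finsupp.sum_add_index' (fun p => map_zero _)
      (fun p => map_add _)]
    split_ifs <;> simp [add_mul]
  | single p P =>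
    have hs : (Finsupp.single p P).sum (fun p P => expPoly p P) = expPoly p P :=
      Finsupp.sum_single_index (map_zero _)
    rw [normalForm_single, hs, map_mul (toFiniteDual k n ω γ),
      map_mul (toFiniteDual k n ω γ), map_pow, toFiniteDual_Ψ, toFiniteDual_F₁,
      ← Polynomial.aeval_algHom_apply, toFiniteDual_F₂, mul_assoc,
      eval_psi_mul _ _ _ _ hl, eval_aeval_formTwo_mul _ _ _ _ hl, eval_formOne_pow _ _ hl,
      expPoly_apply]
    split_ifs <;> simp [mul_assoc]

theorem eval_toFiniteDual_sum_normalForm (c : ℕ → RootPair k n ω →₀ k[X]) (i j : ℤ) {l : ℕ}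
    (hl : l < n) : eval (mon i j l)
      (toFiniteDual k n ω γ (∑ m ∈ Finset.range n, normalForm n m (c m))) =
      (c l).sum (fun p P => expPoly p P) i j * qFactorial γ l := by
  rw [map_sum, map_sum, Finset.sum_eq_single_of_mem l (Finset.mem_range.2 hl),
    eval_toFiniteDual_normalForm _ _ _ _ hl, if_pos rfl]
  intro m _ hm
  rw [eval_toFiniteDual_normalForm _ _ _ _ hl, if_neg hm.symm]

theorem toFiniteDual_injective : Function.Injective (toFiniteDual k n ω γ) := by
  rw [injective_iff_map_eq_zero]
  intro a ha
  obtain ⟨c, rfl⟩ := exists_eq_sum_normalForm a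
  refine Finset.sum_eq_zero fun l hl => ?_
  have hl := Finset.mem_range.1 hl
  have h : c l = 0 := eq_zero_of_sum_expPoly_eq_zero <| by
    ext i j
    have h := eval_toFiniteDual_sum_normalForm (γ := γ) c i j hl
    rw [ha, map_zero] at h
    exact (mul_eq_zero.1 h.symm).resolve_right (qFactorial_ne_zero hl)
  rw [h, map_zero]

end LiuDual

/-! ### Surjectivity -/

namespace LiuDual

open LiuAlgebra FiniteDual RootPair

section

variable {k : Type*} [Field k] [CharZero k] {n ω : ℕ} [NeZero n] [NeZero ω]

/-- A function on `ℤ × ℤ` invariant under `(ω, -n)` whose two discrete derivatives are polynomials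
in `λ(i, j) = i / ω + j / n` is itself a polynomial in `λ`. -/
theorem exists_eq_eval_linChar {ψ : ℤ → ℤ → k} (hψ : ∀ i j, ψ (i + ω) j = ψ i (j + n))
    {P Q : k[X]} (hP : ∀ i j, ψ (i + 1) j = ψ i j + P.eval (linChar k n ω i j))
    (hQ : ∀ i j, ψ i (j + 1) = ψ i j + Q.eval (linChar k n ω i j)) :
    ∃ R : k[X], ∀ i j, ψ i j = R.eval (linChar k n ω i j) := by
  have hω : (ω : k) ≠ 0 := Nat.cast_ne_zero.2 (NeZero.ne ω)
  have hn : (n : k) ≠ 0 := Nat.cast_ne_zero.2 (NeZero.ne n)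
  obtain ⟨R, hR⟩ := exists_eval_add_sub_eval (one_div_ne_zero hω) P
  -- after subtracting the antiderivative, the function depends on `j` only
  let h : ℤ → k := fun j => ψ 0 j - R.eval (linChar k n ω 0 j)
  have hh : ∀ i j, ψ i j - R.eval (linChar k n ω i j) = h j := by
    intro i j
    have step : ∀ i, ψ (i + 1) j - R.eval (linChar k n ω (i + 1) j) =
        ψ i j - R.eval (linChar k n ω i j) := by
      intro i
      rw [hP, linChar_one_add, ← hR]
      ring
    induction i with
    | zero => rfl
    | succ i ih => rw [step, ih]
    | pred i ih => rw [← step, sub_add_cancel, ih]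
  -- its derivative in `j` is a polynomial in `λ` that is constant in `i`, hence a constant
  have hc : Q - (taylor (1 / (n : k)) R - R) = C (h 1 - h 0) := by
    refine eq_of_eval_linChar_eq (n := n) (ω := ω) fun i => ?_
    have h0 := hh i 0
    have h1 := hh i (0 + 1)
    rw [hQ, linChar_add_one] at h1
    rw [eval_sub, eval_sub, taylor_eval, eval_C, ← h0, ← zero_add (1 : ℤ), ← h1]
    ring
  have hstep : ∀ j, h (j + 1) = h j + (h 1 - h 0) := by
    intro j
    have h2 := congrArg (eval (linChar k n ω 0 j)) hc
    rw [eval_sub, eval_sub, taylor_eval, eval_C] at h2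
    rw [← h2, ← hh 0 j, ← hh 0 (j + 1), hQ, linChar_add_one]
    ring
  have hlin : ∀ j, h j = h 0 + j * (h 1 - h 0) := by
    intro j
    induction j with
    | zero => simp
    | succ j ih => rw [hstep, ih]; push_cast; ring
    | pred j ih =>
      have h3 := hstep (-j - 1)
      rw [sub_add_cancel, ih] at h3
      rw [← sub_eq_iff_eq_add.2 h3]
      push_cast
      ring
  -- periodicity makes that constant vanish
  have hper : h n = h 0 := by
    rw [← hh 0 n, ← hh ω 0]
    have h4 := hψ 0 0
    rw [zero_add, zero_add] at h4
    rw [h4]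
    simp [linChar, hω, hn]
  have hzero : h 1 - h 0 = 0 := by
    have h5 := hlin n
    rw [hper, left_eq_add, Int.cast_natCast] at h5
    exact (mul_eq_zero.1 h5).resolve_left hn
  refine ⟨R + C (h 0), fun i j => ?_⟩
  rw [eval_add, eval_C, ← sub_eq_iff_eq_add', hh, hlin, hzero, mul_zero, add_zero]

variable {V : Type*} [AddCommGroup V] [Module k V] {x g : (Module.End k V)ˣ}

omit [CharZero k] [NeZero n] [NeZero ω] in
theorem zpow_mul_zpow_add_ω (hg : g ^ n = x ^ ω) (hxg : Commute x g) (i j : ℤ) :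
    x ^ (i + ω) * g ^ j = x ^ i * g ^ (j + n) := by
  rw [zpow_add, zpow_add, zpow_natCast, zpow_natCast, hg, mul_assoc,
    ((hxg.pow_left ω).zpow_right j).eq]

/-- The matrix coefficients of `x ^ i g ^ j` at a generalized simultaneous eigenvector are a
character times a polynomial in `λ`. -/
theorem exists_apply_eq_expPoly (hg : g ^ n = x ^ ω) (hxg : Commute x g) (e : V →ₗ[k] k)
    (p : RootPair k n ω) (N M : ℕ) (v : V)
    (hx : (((x : Module.End k V) - (p.1.1 : k) • (1 : Module.End k V)) ^ N) v = 0)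
    (hy : (((g : Module.End k V) - (p.1.2 : k) • (1 : Module.End k V)) ^ M) v = 0) :
    ∃ P : k[X], ∀ i j,
      e (((x ^ i * g ^ j : (Module.End k V)ˣ) : Module.End k V) v) = expPoly p P i j := by
  set D : Module.End k V := (x : Module.End k V) - (p.1.1 : k) • (1 : Module.End k V)
  set E : Module.End k V := (g : Module.End k V) - (p.1.2 : k) • (1 : Module.End k V)
  have hDE : Commute D E := by
    have h : Commute (x : Module.End k V) (g : Module.End k V) := hxg.units_val
    have h1 : ∀ (c : k) (f : Module.End k V), Commute f (c • (1 : Module.End k V)) := fun c f =>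
      (Commute.one_right f).smul_right c
    exact ((h.sub_right (h1 _ _)).sub_left (h1 _ _).symm)
  induction N generalizing M v with
  | zero => exact ⟨0, fun i j => by rw [show v = 0 from hx]; simp⟩
  | succ N ihN =>
    induction M generalizing v with
    | zero => exact ⟨0, fun i j => by rw [show v = 0 from hy]; simp⟩
    | succ M ihM =>
      obtain ⟨P, hP⟩ := ihN (M + 1) (D v) (by rw [← Module.End.mul_apply, ← pow_succ, hx])
        (by
          rw [← Module.End.mul_apply, (hDE.symm.pow_left _).eq, Module.End.mul_apply, hy, map_zero])
      obtain ⟨Q, hQ⟩ := ihM (E v)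
        (by rw [← Module.End.mul_apply, (hDE.pow_left _).eq, Module.End.mul_apply, hx, map_zero])
        (by rw [← Module.End.mul_apply, ← pow_succ, hy])
      have hxv : (x : Module.End k V) v = D v + (p.1.1 : k) • v := by simp [D]
      have hgv : (g : Module.End k V) v = E v + (p.1.2 : k) • v := by simp [E]
      have hα : (p.1.1 : k) ≠ 0 := p.1.1.ne_zero
      have hβ : (p.1.2 : k) ≠ 0 := p.1.2.ne_zero
      obtain ⟨R, hR⟩ := exists_eq_eval_linChar (n := n) (ω := ω)
        (ψ := fun i j => (char p i j)⁻¹ *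
          e (((x ^ i * g ^ j : (Module.End k V)ˣ) : Module.End k V) v))
        (P := C (p.1.1 : k)⁻¹ * P) (Q := C (p.1.2 : k)⁻¹ * Q)
        (fun i j => by
          rw [zpow_mul_zpow_add_ω hg hxg]
          congr 2
          rw [char_add_ω, ← add_zero i, char_add, add_zero, mul_comm]
          have hp : (p.1.1 : k) ^ ω = (p.1.2 : k) ^ n := by exact_mod_cast congrArg Units.val p.2
          rw [hp]
          simp [char])
        (fun i j => by
          have hch : char p (i + 1) j = p.1.1 * char p i j := by
            rw [← add_zero j, char_add, add_zero, mul_comm]; simp [char]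
          have hu : (x ^ (i + 1) * g ^ j : (Module.End k V)ˣ) = x ^ i * g ^ j * x := by
            rw [zpow_add_one, mul_assoc, mul_assoc, (hxg.zpow_right j).eq]
          have hPij := hP i j
          rw [expPoly_apply] at hPij
          rw [hu, Units.val_mul (x ^ i * g ^ j), Module.End.mul_apply, hxv, map_add, map_add, hPij,
            map_smul, map_smul, smul_eq_mul, hch, Polynomial.eval_mul, eval_C]
          have hne := char_ne_zero p i j
          field_simp
          ring)
        (fun i j => by
          have hu : (x ^ i * g ^ (j + 1) : (Module.End k V)ˣ) = x ^ i * g ^ j * g := by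
            rw [zpow_add_one, mul_assoc]
          have hQij := hQ i j
          rw [expPoly_apply] at hQij
          rw [hu, Units.val_mul (x ^ i * g ^ j), Module.End.mul_apply, hgv, map_add, map_add, hQij,
            map_smul, map_smul, smul_eq_mul, char_add_one, Polynomial.eval_mul, eval_C]
          have hne := char_ne_zero p i j
          field_simp
          ring)
      refine ⟨R, fun i j => ?_⟩
      rw [expPoly_apply, ← hR, mul_inv_cancel_left₀ (char_ne_zero p i j)]

omit [CharZero k] [NeZero n] [NeZero ω] in
theorem pow_mem_maxGenEigenspace {f : Module.End k V} {μ : k} {v : V}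
    (h : v ∈ f.maxGenEigenspace μ) (m : ℕ) : v ∈ (f ^ m).maxGenEigenspace (μ ^ m) := by
  rw [Module.End.mem_maxGenEigenspace] at h ⊢
  obtain ⟨N, hN⟩ := h
  have hc : Commute f (μ • (1 : Module.End k V)) := (Commute.one_right f).smul_right μ
  have hf := hc.geom_sum₂_mul m
  rw [_root_.smul_pow, one_pow] at hf
  have hc' : Commute (∑ i ∈ Finset.range m, f ^ i * (μ • (1 : Module.End k V)) ^ (m - 1 - i))
      (f - μ • (1 : Module.End k V)) := by
    refine Commute.sum_left _ _ _ fun i _ => ?_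
    exact ((Commute.refl f).sub_right hc).pow_left i |>.mul_left
      ((hc.symm.sub_right (Commute.refl _)).pow_left _)
  refine ⟨N, ?_⟩
  rw [← hf, hc'.mul_pow, Module.End.mul_apply, hN, map_zero]

omit [CharZero k] [NeZero n] [NeZero ω] in
/-- A pair of eigenvalues `(α, β)` of `x` and `g` with `x ^ ω = g ^ n` is a root pair. -/
theorem exists_rootPair_of_mem_maxGenEigenspace (hg : g ^ n = x ^ ω) {α β : k} {v : V}
    (hv : v ≠ 0)
    (hx : v ∈ (x : Module.End k V).maxGenEigenspace α)
    (hy : v ∈ (g : Module.End k V).maxGenEigenspace β) :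
    ∃ p : RootPair k n ω, (p.1.1 : k) = α ∧ (p.1.2 : k) = β := by
  have hne : ∀ (u : (Module.End k V)ˣ) (c : k), v ∈ (u : Module.End k V).maxGenEigenspace c →
      c ≠ 0 := by
    rintro u _ h rfl
    obtain ⟨N, hN⟩ := (Module.End.mem_maxGenEigenspace _ _ _).1 h
    rw [zero_smul, sub_zero, ← Units.val_pow_eq_pow_val] at hN
    refine hv ?_
    calc v = (((u ^ N)⁻¹ * u ^ N : (Module.End k V)ˣ) : Module.End k V) v := by simp
      _ = 0 := by rw [Units.val_mul, Module.End.mul_apply, hN, map_zero]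
  have heq : α ^ ω = β ^ n := by
    by_contra h
    have h1 := pow_mem_maxGenEigenspace hx ω
    have h2 := pow_mem_maxGenEigenspace hy n
    rw [← Units.val_pow_eq_pow_val] at h1 h2
    rw [hg] at h2
    exact hv (Submodule.disjoint_def.1 (Module.End.disjoint_genEigenspace _ h ⊤ ⊤) v h1 h2)
  exact ⟨⟨(Units.mk0 α (hne x α hx), Units.mk0 β (hne g β hy)), Units.ext (by simpa using heq)⟩,
    rfl, rfl⟩

/-- The matrix coefficients of `x ^ i g ^ j` in a finite-dimensional space are sums of functions
`χ P(λ)`. -/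
theorem exists_apply_eq_sum_expPoly [IsAlgClosed k] [FiniteDimensional k V] (hg : g ^ n = x ^ ω)
    (hxg : Commute x g) (e : V →ₗ[k] k) (v : V) :
    ∃ c : RootPair k n ω →₀ k[X], ∀ i j,
      e (((x ^ i * g ^ j : (Module.End k V)ˣ) : Module.End k V) v) =
      c.sum (fun p P => expPoly p P) i j := by
  let L : (RootPair k n ω →₀ k[X]) →ₗ[k] (ℤ → ℤ → k) := Finsupp.lsum k expPoly
  let φ : V →ₗ[k] (ℤ → ℤ → k) := LinearMap.pi fun i => LinearMap.pi fun j =>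
    e ∘ₗ ((x ^ i * g ^ j : (Module.End k V)ˣ) : Module.End k V)
  suffices h : (LinearMap.range L).comap φ = ⊤ by
    obtain ⟨c, hc⟩ := h.ge (Submodule.mem_top (x := v))
    exact ⟨c, fun i j => (congrFun (congrFun hc i) j).symm⟩
  let f : Bool → Module.End k V := fun b => if b then g else x
  have hfx : f false = x := rfl
  have hfg : f true = g := rfl
  have hcomm : Commute (x : Module.End k V) (g : Module.End k V) := hxg.units_val
  have htop :=
    Module.End.iSup_iInf_maxGenEigenspace_eq_top_of_iSup_maxGenEigenspace_eq_top_of_commute f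
      (fun b b' _ => by
        cases b <;> cases b'
        · exact Commute.refl _
        · exact hcomm
        · exact hcomm.symm
        · exact Commute.refl _)
      (fun b => Module.End.iSup_maxGenEigenspace_eq_top (f b))
  refine eq_top_iff.2 (htop.symm.le.trans (iSup_le fun χ => fun w hw => ?_))
  have hw := (Submodule.mem_iInf _).1 hw
  have h1 := hw false
  have h2 := hw true
  rw [hfx] at h1
  rw [hfg] at h2
  by_cases h0 : w = 0
  · rw [h0]; exact Submodule.zero_mem _
  obtain ⟨p, hα, hβ⟩ := exists_rootPair_of_mem_maxGenEigenspace hg h0 h1 h2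
  obtain ⟨N, hN⟩ := (Module.End.mem_maxGenEigenspace _ _ _).1 h1
  obtain ⟨M, hM⟩ := (Module.End.mem_maxGenEigenspace _ _ _).1 h2
  obtain ⟨P, hP⟩ := exists_apply_eq_expPoly hg hxg e p N M w (hα ▸ hN) (hβ ▸ hM)
  refine ⟨Finsupp.single p P, ?_⟩
  ext i j
  simp only [L, Finsupp.lsum_single]
  exact (hP i j).symm

end

variable {k : Type*} [Field k] [CharZero k] [IsAlgClosed k] {n ω : ℕ} {γ : k} [NeZero n] [NeZero ω]
  [hγ : Fact (IsPrimitiveRoot γ n)]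

theorem toFiniteDual_surjective : Function.Surjective (toFiniteDual k n ω γ) := by
  intro f
  obtain ⟨I, _, _, e, he⟩ := IsCofinite.exists_factor f.2
  let π := Ideal.Quotient.mkₐ k I
  -- `B` acts on `B ⧸ I` by left multiplication
  let ρ : LiuAlgebra k n ω γ →ₐ[k] Module.End k (LiuAlgebra k n ω γ ⧸ I) :=
    (Algebra.lmul k (LiuAlgebra k n ω γ ⧸ I)).comp π
  let u : (LiuAlgebra k n ω γ)ˣ →* (Module.End k (LiuAlgebra k n ω γ ⧸ I))ˣ :=
    Units.map (ρ : LiuAlgebra k n ω γ →* _)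
  have h : ∀ l : ℕ, ∃ c : RootPair k n ω →₀ k[X], ∀ i j, eval (mon i j l) f =
      c.sum (fun p P => expPoly p P) i j := by
    intro l
    obtain ⟨c, hc⟩ := exists_apply_eq_sum_expPoly (x := u xUnit) (g := u gUnit) (n := n) (ω := ω)
      (by rw [← map_pow, ← map_pow, gUnit_pow]) (xUnit_commute_gUnit.map u) e (π (gen .y ^ l))
    refine ⟨c, fun i j => ?_⟩
    rw [← hc, ← map_zpow u, ← map_zpow u, ← map_mul u]
    exact (he _).trans (congrArg e (map_mul π _ _))
  choose c hc using h
  refine ⟨∑ l ∈ Finset.range n, normalForm n l ((qFactorial γ l)⁻¹ • c l),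
    ext_mon fun i j l hl => ?_⟩
  rw [eval_toFiniteDual_sum_normalForm (fun l => (qFactorial γ l)⁻¹ • c l) _ _ hl, hc,
    Finsupp.sum_smul_index' (fun p => map_zero _)]
  simp only [map_smul]
  rw [← Finsupp.smul_sum, Pi.smul_apply, Pi.smul_apply, smul_eq_mul, mul_right_comm,
    inv_mul_cancel₀ (qFactorial_ne_zero hl), one_mul]

variable (k n ω γ) in
/-- The isomorphism of algebras `B_∘(n, ω, γ) ≃ B(n, ω, γ)°`. -/
def equivFiniteDual : LiuDual k n ω ≃ₐ[k] FiniteDual k (LiuAlgebra k n ω γ) :=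
  AlgEquiv.ofBijective (toFiniteDual k n ω γ) ⟨toFiniteDual_injective, toFiniteDual_surjective⟩

end LiuDual

end

noncomputable section

/-! ### Transport of the Hopf algebra structure -/

namespace HopfStructure

open Algebra.TensorProduct

variable {k A H : Type*} [Field k] [Ring A] [Algebra k A] [Ring H] [HopfAlgebra k H]

variable (e : A ≃ₐ[k] H)

/-- The comultiplication of `H` transported along `e`. -/
def transportComul : A →ₐ[k] A ⊗[k] A :=
  (map (e.symm : H →ₐ[k] A) (e.symm : H →ₐ[k] A)).comp ((Bialgebra.comulAlgHom k H).comp e)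

theorem map_transportComul (a : A) : map (e : A →ₐ[k] H) (e : A →ₐ[k] H) (transportComul e a) =
    Coalgebra.comul (R := k) (e a) := by
  have h : (map (e : A →ₐ[k] H) (e : A →ₐ[k] H)).comp
      (map (e.symm : H →ₐ[k] A) (e.symm : H →ₐ[k] A)) = AlgHom.id k _ := by
    rw [← map_comp]; simp
  exact AlgHom.congr_fun h _

theorem map_equiv_injective : Function.Injective (map (e : A →ₐ[k] H) (e : A →ₐ[k] H)) :=
  (congr e e).injective

theorem assoc_map_transportComul (t : A ⊗[k] A) :
    map (e : A →ₐ[k] H) (map (e : A →ₐ[k] H) (e : A →ₐ[k] H))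
      (TensorProduct.assoc k A A A (map (transportComul e) (.id k A) t)) =
    TensorProduct.assoc k H H H (LinearMap.rTensor H Coalgebra.comul
      (map (e : A →ₐ[k] H) (e : A →ₐ[k] H) t)) := by
  have h : ∀ (s : A ⊗[k] A) (b : A), map (e : A →ₐ[k] H) (map (e : A →ₐ[k] H) (e : A →ₐ[k] H))
      (TensorProduct.assoc k A A A (s ⊗ₜ b)) =
      TensorProduct.assoc k H H H (map (e : A →ₐ[k] H) (e : A →ₐ[k] H) s ⊗ₜ e b) := by
    intro s b
    induction s with
    | zero => simp
    | add x y hx hy => rw [TensorProduct.add_tmul, map_add, map_add, hx, hy, map_add,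
        TensorProduct.add_tmul, map_add]
    | tmul x y => simp
  induction t with
  | zero => simp
  | add x y hx hy => simp only [map_add, hx, hy]
  | tmul x y => rw [map_tmul, AlgHom.id_apply, h, map_transportComul]; rfl

theorem map_map_transportComul (t : A ⊗[k] A) :
    map (e : A →ₐ[k] H) (map (e : A →ₐ[k] H) (e : A →ₐ[k] H))
      (map (.id k A) (transportComul e) t) =
    LinearMap.lTensor H Coalgebra.comul (map (e : A →ₐ[k] H) (e : A →ₐ[k] H) t) := by
  induction t with
  | zero => simp
  | add x y hx hy => simp only [map_add, hx, hy]
  | tmul x y => rw [map_tmul, map_tmul, map_transportComul]; rfl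

/-- The Hopf algebra structure of `H` transported along an isomorphism of algebras. -/
def transport : HopfStructure k A where
  comul := transportComul e
  counit := (Bialgebra.counitAlgHom k H).comp e
  antipode := e.symm.toLinearMap ∘ₗ HopfAlgebra.antipode k ∘ₗ e.toLinearMap
  coassoc := by
    refine AlgHom.ext fun a => (congr e (congr e e)).injective ?_
    refine (assoc_map_transportComul e (transportComul e a)).trans
      (Eq.trans ?_ (map_map_transportComul e (transportComul e a)).symm)
    rw [map_transportComul, Coalgebra.coassoc_apply]
  rTensor_counit_comp_comul := by
    have h : ∀ t, map (.id k k) (e : A →ₐ[k] H)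
        (map ((Bialgebra.counitAlgHom k H).comp (e : A →ₐ[k] H)) (.id k A) t) =
        LinearMap.rTensor H Coalgebra.counit (map (e : A →ₐ[k] H) (e : A →ₐ[k] H) t) := by
      intro t
      induction t with
      | zero => simp
      | add x y hx hy => simp only [map_add, hx, hy]
      | tmul x y => rfl
    refine AlgHom.ext fun a => (congr AlgEquiv.refl e).injective ((h (transportComul e a)).trans ?_)
    rw [map_transportComul, Coalgebra.rTensor_counit_comul]
    rfl
  lTensor_counit_comp_comul := by
    have h : ∀ t, map (e : A →ₐ[k] H) (.id k k)
        (map (.id k A) ((Bialgebra.counitAlgHom k H).comp (e : A →ₐ[k] H)) t) =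
        LinearMap.lTensor H Coalgebra.counit (map (e : A →ₐ[k] H) (e : A →ₐ[k] H) t) := by
      intro t
      induction t with
      | zero => simp
      | add x y hx hy => simp only [map_add, hx, hy]
      | tmul x y => rfl
    refine AlgHom.ext fun a => (congr e AlgEquiv.refl).injective ((h (transportComul e a)).trans ?_)
    rw [map_transportComul, Coalgebra.lTensor_counit_comul]
    rfl
  mul_antipode_rTensor_comul := by
    have h : ∀ t, e (LinearMap.mul' k A (LinearMap.rTensor A
        (e.symm.toLinearMap ∘ₗ HopfAlgebra.antipode k ∘ₗ e.toLinearMap) t)) =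
        LinearMap.mul' k H (LinearMap.rTensor H (HopfAlgebra.antipode k)
          (map (e : A →ₐ[k] H) (e : A →ₐ[k] H) t)) := by
      intro t
      induction t with
      | zero => simp
      | add x y hx hy => simp only [map_add, hx, hy]
      | tmul x y => simp
    refine LinearMap.ext fun a => e.injective ((h _).trans ?_)
    rw [AlgHom.toLinearMap_apply, map_transportComul,
      HopfAlgebra.mul_antipode_rTensor_comul_apply]
    exact (e.commutes _).symm
  mul_antipode_lTensor_comul := by
    have h : ∀ t, e (LinearMap.mul' k A (LinearMap.lTensor A
        (e.symm.toLinearMap ∘ₗ HopfAlgebra.antipode k ∘ₗ e.toLinearMap) t)) =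
        LinearMap.mul' k H (LinearMap.lTensor H (HopfAlgebra.antipode k)
          (map (e : A →ₐ[k] H) (e : A →ₐ[k] H) t)) := by
      intro t
      induction t with
      | zero => simp
      | add x y hx hy => simp only [map_add, hx, hy]
      | tmul x y => simp
    refine LinearMap.ext fun a => e.injective ((h _).trans ?_)
    rw [AlgHom.toLinearMap_apply, map_transportComul,
      HopfAlgebra.mul_antipode_lTensor_comul_apply]
    exact (e.commutes _).symm

end HopfStructure

end

open LiuDual in
/-- `B_∘(n, ω, γ)` is a Hopf algebra with the stated operations, isomorphic as a Hopf algebra to the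
finite dual of the generalized Liu algebra `B(n, ω, γ)`. -/
theorem theorem4p4 (k : Type*) [Field k] [IsAlgClosed k] [CharZero k] (n ω : ℕ) [NeZero n]
    [NeZero ω] (γ : k) [Fact (IsPrimitiveRoot γ n)] :
    ∃ 𝓗 : HopfStructure k (LiuDual k n ω),
      𝓗.comul F₁ = 1 ⊗ₜ[k] F₁ + F₁ ⊗ₜ[k] Ψ (RootPair.one_root n ω γ) ∧
      𝓗.comul F₂ = 1 ⊗ₜ[k] F₂ + F₂ ⊗ₜ[k] 1 - crossTerm γ ∧
      (∀ p : RootPair k n ω, 𝓗.comul (Ψ p) =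
        (Ψ p ⊗ₜ[k] Ψ p) * (1 ⊗ₜ[k] 1 + (1 - (p.1.1 : k) ^ ω) • crossTerm γ)) ∧
      𝓗.counit F₁ = 0 ∧
      𝓗.counit F₂ = 0 ∧
      (∀ p : RootPair k n ω, 𝓗.counit (Ψ p) = 1) ∧
      𝓗.antipode F₁ = -(γ ^ (n - 1) • (Ψ (RootPair.one_root n ω γ) ^ (n - 1) * F₁)) ∧
      𝓗.antipode F₂ = -F₂ ∧
      (∀ p : RootPair k n ω, 𝓗.antipode (Ψ p) = Ψ p⁻¹) ∧
      letI := 𝓗.toHopfAlgebra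
      ∃ Θ : LiuDual k n ω ≃ₐc[k] FiniteDual k (LiuAlgebra k n ω γ),
        ∀ a, Θ (HopfAlgebra.antipode k a) = HopfAlgebra.antipode k (Θ a) := by
  let e := equivFiniteDual k n ω γ
  have eΨ : ∀ p : RootPair k n ω, e (Ψ p) = LiuAlgebra.psi p := toFiniteDual_Ψ
  have e₁ : e F₁ = LiuAlgebra.formOne k n ω γ := toFiniteDual_F₁
  have e₂ : e F₂ = LiuAlgebra.formTwo k n ω γ := toFiniteDual_F₂
  let T := Algebra.TensorProduct.map (e : LiuDual k n ω →ₐ[k] FiniteDual k (LiuAlgebra k n ω γ))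
    (e : LiuDual k n ω →ₐ[k] FiniteDual k (LiuAlgebra k n ω γ))
  have hT : T = Algebra.TensorProduct.map (toFiniteDual k n ω γ) (toFiniteDual k n ω γ) := rfl
  have hTt : ∀ a b, T (a ⊗ₜ b) = e a ⊗ₜ e b := fun _ _ => rfl
  have hcomul : ∀ a t, T t = Coalgebra.comul (R := k) (e a) →
      (HopfStructure.transport e).comul a = t := fun a t h =>
    HopfStructure.map_equiv_injective e ((HopfStructure.map_transportComul e a).trans h.symm)
  have hcounit : ∀ a, (HopfStructure.transport e).counit a =
      FiniteDual.eval (LiuAlgebra.mon 0 0 0) (e a) := fun a => by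
    rw [LiuAlgebra.mon_zero]; rfl
  have hanti : ∀ a b, e b = HopfAlgebra.antipode k (e a) →
      (HopfStructure.transport e).antipode a = b := fun a b h =>
    e.injective ((e.apply_symm_apply _).trans h.symm)
  have hn := NeZero.pos n
  refine ⟨HopfStructure.transport e,
    ?_, ?_, fun p => ?_, ?_, ?_, fun p => ?_, ?_, ?_, fun p => ?_, ?_⟩
  · refine hcomul _ _ ?_
    rw [map_add, hTt, hTt, e₁, eΨ, map_one, LiuAlgebra.comul_formOne]
  · refine hcomul _ _ ?_
    rw [map_sub, map_add, hTt, hTt, e₂, map_one, comul_formTwo, hT]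
  · refine hcomul _ _ ?_
    rw [map_mul, map_add, map_smul, hTt, hTt, eΨ, map_one, comul_psi, hT]
  · rw [hcounit, e₁, LiuAlgebra.eval_formOne _ _ hn, if_neg (by simp)]
  · rw [hcounit, e₂, LiuAlgebra.eval_formTwo _ _ hn, if_pos rfl, linChar_zero]
  · rw [hcounit, eΨ, LiuAlgebra.eval_psi _ _ _ hn, if_pos rfl, RootPair.char_zero]
  · refine hanti _ _ ?_
    rw [map_neg, map_smul, map_mul, map_pow, e₁, eΨ, LiuAlgebra.antipode_formOne]
  · refine hanti _ _ ?_
    rw [map_neg, e₂, LiuAlgebra.antipode_formTwo]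
  · refine hanti _ _ ?_
    rw [eΨ, eΨ, LiuAlgebra.antipode_psi]
  · let _ := (HopfStructure.transport e).toHopfAlgebra
    exact ⟨BialgEquiv.ofAlgEquiv e rfl (AlgHom.ext fun a => HopfStructure.map_transportComul e a),
      fun a => e.apply_symm_apply _⟩
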